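/- Let $\lambda,\nu:\mathbb{N}\to\mathbb{R}$ be birth and death rates with $\lambda>0$ on $\mathbb{N}$, $\nu_0=0$ and $\nu>0$ on $\mathbb{N}\setminus\{0\}$, and let $(X_t)_{t\ge0}$ be the (minimal, irreducible) birth-death process on $\mathbb{N}$ with these rates, which jumps from $x$ to $x+1$ at rate $\lambda_x$ and from $x$ to $x-1$ at rate $\nu_x$. Assume that it is non-explosive, and let $P_tf(x)=\mathbb{E}_x[f(X_t)]$ be its semigroup. Write $\partial f(x)=f(x+1)-f(x)$. Let $(X_{1,t})_{t\ge0}$ be the $1$-modification, i.e. the birth-death process with birth rates $\lambda^1_x=\lambda_{x+1}$ and death rates $\nu^1_x=\nu_x$, and, for $V:\mathbb{N}\to[0,\infty)$ and $g:\mathbb{N}\to[0,\infty)$, let $$P_{1,t}^{V}g(x)=\mathbb{E}_x\Big[g(X_{1,t})\exp\Big(-\int_0^tV(X_{1,s})\,ds\Big)\Big]\in[0,\infty].$$ Let $\mathcal{I}\subseteq\mathbb{R}$ be an open interval and let $\varphi:\mathcal{I}\to\mathbb{R}$ be a smooth convex function such that $\varphi''>0$ and $-1/\varphi''$ is convex on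 $\mathcal{I}$. For $r,r+s\in\mathcal{I}$ set $B^\varphi(r,s)=(\varphi'(r+s)-\varphi'(r))\,s\ \ (\ge 0)$. Assume that $\lambda$ is non-increasing and $\nu$ is non-decreasing, and let $f:\mathbb{N}\to\mathcal{I}$ satisfy $\sup_{y\in\mathbb{N}}|\partial f(y)|<\infty$. Then $V_1(x):=\nu_{x+1}-\nu^1_x+\lambda_x-\lambda^1_x=\partial(\nu-\lambda)(x)$ is non-negative, and for every $t\ge0$ and $x\in\mathbb{N}$ the variable $f(X_t)$ is integrable under $\mathbb{P}_x$, $P_tf(x)\in\mathcal{I}$, and $$B^\varphi\big(P_tf,\partial P_tf\big)(x)\ \le\ P_{1,t}^{V_1}\,B^\varphi(f,\partial f)(x),$$ where the right-hand side may be $+\infty$. -/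

import Mathlib

open MeasureTheory ProbabilityTheory
open scoped ENNReal

noncomputable section

/-- Birth rates `λ` and death rates `ν` of an irreducible birth-death process on `ℕ`:
`λ > 0` on `ℕ`, `ν > 0` on `ℕ \ {0}` and `ν 0 = 0`. -/
structure BirthDeathRates where
  birth : ℕ → ℝ
  death : ℕ → ℝ
  birth_pos : ∀ x, 0 < birth x
  death_zero : death 0 = 0
  death_pos : ∀ x, x ≠ 0 → 0 < death x

/-- The forward discrete gradient `∂f(x) = f(x+1) - f(x)`. -/
def fwdGrad (f : ℕ → ℝ) (x : ℕ) : ℝ := f (x + 1) - f x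

namespace BirthDeathRates

instance : IsProbabilityMeasure (expMeasure 1) := isProbabilityMeasure_expMeasure one_pos

/-- The sample space: at each step, a clock value in `ℝ` and a mark in `[0,1]`. -/
abbrev Noise : Type := ℕ → ℝ × unitInterval

/-- The driving randomness: independent standard exponential clocks and independent uniform
marks. -/
def noise : Measure Noise :=
  Measure.infinitePi fun _ : ℕ => (expMeasure 1).prod (volume : Measure unitInterval)

variable (r : BirthDeathRates)

/-- Total jump rate out of `x`. -/
def rate (x : ℕ) : ℝ := r.birth x + r.death x

/-- One jump from `y` with mark `u`: if `u` is uniform on `[0,1]`, the new state is `y + 1` with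
probability `λ_y / (λ_y + ν_y)` and `y - 1` with probability `ν_y / (λ_y + ν_y)`. -/
def step (y : ℕ) (u : unitInterval) : ℕ :=
  if (u : ℝ) * r.rate y ≤ r.birth y then y + 1 else y - 1

/-- The embedded jump chain started at `x`. -/
def chain (x : ℕ) (ω : Noise) : ℕ → ℕ
  | 0 => x
  | n + 1 => r.step (chain x ω n) (ω n).2

/-- The time of the `n`-th jump. The `k`-th holding time is, given the jump chain, exponential
with parameter the total jump rate at the current state. -/
def jumpTime (x : ℕ) (ω : Noise) (n : ℕ) : ℝ :=
  ∑ k ∈ Finset.range n, (ω k).1 / r.rate (r.chain x ω k)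

/-- The event `t < ζ`, where `ζ = sup_n jumpTime n` is the explosion time. -/
def alive (x : ℕ) (t : ℝ) : Set Noise := {ω | ∃ n, t < r.jumpTime x ω n}

/-- The minimal birth-death process `X_t` started at `x`: it equals the `n`-th state of the jump
chain between the `n`-th and the `(n+1)`-th jump (its value is only used on `alive x t`). -/
def process (x : ℕ) (t : ℝ) (ω : Noise) : ℕ :=
  r.chain x ω (sInf {n | t < r.jumpTime x ω (n + 1)})

/-- Almost surely, from every starting point, the explosion time is infinite. -/
def NonExplosive : Prop := ∀ x : ℕ, ∀ᵐ ω ∂noise, ∀ t : ℝ, ω ∈ r.alive x t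

/-- The semigroup `P_t f(x) = 𝔼_x[f(X_t); t < ζ]` on real functions (meaningful if `f(X_t)` is
integrable). -/
def semigroup (t : ℝ) (f : ℕ → ℝ) (x : ℕ) : ℝ :=
  ∫ ω in r.alive x t, f (r.process x t ω) ∂noise

/-- The Feynman-Kac semigroup
`P_t^V g(x) = 𝔼_x[g(X_t) exp(-∫_0^t V(X_s) ds); t < ζ]` on non-negative functions, with values
in `[0,∞]`. -/
def feynmanKac (V : ℕ → ℝ) (t : ℝ) (g : ℕ → ℝ≥0∞) (x : ℕ) : ℝ≥0∞ :=
  ∫⁻ ω in r.alive x t, g (r.process x t ω) *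
    ENNReal.ofReal (Real.exp (-∫ s in (0 : ℝ)..t, V (r.process x s ω))) ∂noise

/-- The rates `λ^u_x = (u_{x+1} / u_x) λ_{x+1}` and `ν^u_x = (u_{x-1} / u_x) ν_x` of the
`u`-modification (at `x = 0` the death rate is `0`). -/
def modification (u : ℕ → ℝ) (hu : ∀ x, 0 < u x) : BirthDeathRates where
  birth x := u (x + 1) / u x * r.birth (x + 1)
  death x := u (x - 1) / u x * r.death x
  birth_pos x := mul_pos (div_pos (hu _) (hu _)) (r.birth_pos _)
  death_zero := by simp [r.death_zero]
  death_pos x hx := mul_pos (div_pos (hu _) (hu _)) (r.death_pos x hx)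

/-- The potential `V_u(x) = ν_{x+1} - ν^u_x + λ_x - λ^u_x`. -/
def potential (u : ℕ → ℝ) (hu : ∀ x, 0 < u x) (x : ℕ) : ℝ :=
  r.death (x + 1) - (r.modification u hu).death x + r.birth x - (r.modification u hu).birth x

/-- The `1`-modification. -/
def oneModification : BirthDeathRates := r.modification (fun _ => 1) fun _ => one_pos

/-- The potential `V_1`. -/
def onePotential : ℕ → ℝ := r.potential (fun _ => 1) fun _ => one_pos

end BirthDeathRates

/-- `B^φ(r,s) = (φ'(r+s) - φ'(r)) s`. It is used only where `r` and `r + s` lie in an open interval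
on which `φ` is smooth and convex; there it is non-negative. -/
def bTransform (φ : ℝ → ℝ) (r s : ℝ) : ℝ := (deriv φ (r + s) - deriv φ r) * s

end

/-! Start one copy of the process at `x` and one at `x + 1`. As long as they are neighbours, let
both jump up at rate `λ_{x+1}` and both down at rate `ν_x`; the remaining rate, `(λ_x - λ_{x+1}) +
(ν_{x+1} - ν_x) = V_1(x)`, makes them meet. The lower copy is thus the `1`-modification and meeting
is killing at rate `V_1`. After meeting the gradient is zero, and `B^φ(r, 0) = 0`, so killed paths
contribute nothing. The inequality is then Jensen's inequality for the jointly convex function `(a,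
b) ↦ B^φ(a, b - a)`.

The proof is analytic and builds no coupling. Convexity (`bTransform_convex`) follows from that of
`(r, s) ↦ φ''(r) s ^ 2`, which is where `-1/φ''` enters. It gives a tangent plane `c + α a + β b`
below `B^φ(a, b - a)`, touching at `(P_t f(x), P_t f(x+1))` (`exists_affine_le_bTransform`). On the
diagonal this reads `c + (α + β) a ≤ 0` for `a ∈ I`, an inequality preserved by averaging because
the process is non-explosive. By the backward equation, `W_u(y) = c + α P_u f(y) + β P_u f(y+1)`
then satisfies a subsolution inequality for the killed `1`-modification
(`ofReal_affine_semigroup_le`).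

The Feynman-Kac semigroup solves the corresponding first-jump equation (`feynmanKac_eq`), so
`eq_zero_of_le_jumpIntegral` compares the two. Only `λ` is bounded; deaths merely lower the Lyapunov
functions `1 + x` and `(1 + x) ^ 2`, so no bound on `ν` is needed. -/

noncomputable section
-- Regeneration of the noise after its first coordinate.
namespace BirthDeathRates

instance : IsProbabilityMeasure noise := by unfold noise; infer_instance

/-- Prepending one clock value and one mark to the noise. -/
def consNoise (p : (ℝ × unitInterval) × Noise) : Noise := fun n => Nat.casesOn n p.1 p.2

@[simp] lemma consNoise_zero (p : (ℝ × unitInterval) × Noise) : consNoise p 0 = p.1 := rfl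

@[simp] lemma consNoise_succ (p : (ℝ × unitInterval) × Noise) (n : ℕ) :
    consNoise p (n + 1) = p.2 n := rfl

lemma measurable_consNoise : Measurable consNoise := by
  refine measurable_pi_lambda _ fun n => ?_
  cases n with
  | zero => exact measurable_fst
  | succ n => exact (measurable_pi_apply n).comp measurable_snd

/-- The noise is an independent concatenation of its first coordinate and a copy of itself. -/
lemma map_consNoise :
    Measure.map consNoise (((expMeasure 1).prod (volume : Measure unitInterval)).prod noise) =
      noise := by
  classical
  refine Measure.eq_infinitePi _ fun s A hA => ?_
  -- Filling the unconstrained coordinates with `univ` turns the cylinder into a full product, which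
  -- splits off coordinate `0`.
  set A' : ℕ → Set (ℝ × unitInterval) := fun i => if i ∈ s then A i else Set.univ with hA'
  have hA'm : ∀ i, MeasurableSet (A' i) := fun i => by
    by_cases hi : i ∈ s <;> simp [hA', hi, hA]
  have hpre : consNoise ⁻¹' Set.pi s A =
      A' 0 ×ˢ Set.pi Set.univ (fun i => A' (i + 1)) := by
    ext p
    simp only [Set.mem_preimage, Set.mem_pi, Finset.mem_coe, Set.mem_prod, Set.mem_univ,
      true_imp_iff, hA']
    constructor
    · intro h
      refine ⟨?_, fun i => ?_⟩
      · by_cases h0 : 0 ∈ s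
        · simpa [h0] using h 0 h0
        · simp [h0]
      · by_cases hi : i + 1 ∈ s
        · simpa [hi] using h (i + 1) hi
        · simp [hi]
    · rintro ⟨h0, h1⟩ i hi
      cases i with
      | zero => simpa [hi] using h0
      | succ i => simpa [hi] using h1 i
  have hsm : MeasurableSet (Set.pi (s : Set ℕ) A) :=
    MeasurableSet.pi s.countable_toSet fun i _ => hA i
  rw [Measure.map_apply measurable_consNoise hsm, hpre, Measure.prod_prod]
  set m : Measure (ℝ × unitInterval) := (expMeasure 1).prod volume with hm
  -- If `i + 1 ∈ s` then `i < s.sup id`, so the shifted product is nontrivial only on `range (s.sup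
  -- id)`; restoring coordinate `0` gives `range (s.sup id + 1) ⊇ s`.
  have hprod : noise (Set.pi Set.univ fun i => A' (i + 1)) =
      ∏ i ∈ Finset.range (s.sup id), m (A' (i + 1)) := by
    have : Set.pi Set.univ (fun i => A' (i + 1)) =
        Set.pi (Finset.range (s.sup id) : Set ℕ) (fun i => A' (i + 1)) := by
      ext ω
      simp only [Set.mem_pi, Set.mem_univ, true_imp_iff, Finset.mem_coe, Finset.mem_range]
      refine ⟨fun h i _ => h i, fun h i => ?_⟩
      by_cases hi : i + 1 ∈ s
      · exact h i (Nat.lt_of_succ_le (Finset.le_sup (f := id) hi))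
      · simp [hA', hi]
    rw [this]
    exact Measure.infinitePi_pi _ fun i _ => hA'm _
  rw [hprod, mul_comm, ← Finset.prod_range_succ' (fun i => m (A' i))]
  have hsub : s ⊆ Finset.range (s.sup id + 1) := fun i hi =>
    Finset.mem_range.2 (Nat.lt_succ_of_le (Finset.le_sup (f := id) hi))
  rw [← Finset.prod_subset hsub]
  · exact Finset.prod_congr rfl fun i hi => by simp [hA', hi]
  · intro i _ hi
    simp [hA', hi, hm]

lemma lintegral_noise_eq {F : Noise → ℝ≥0∞} (hF : Measurable F) :
    ∫⁻ ω, F ω ∂noise = ∫⁻ a, ∫⁻ u : unitInterval, ∫⁻ ω, F (consNoise ((a, u), ω)) ∂noise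
      ∂volume ∂(expMeasure 1) := by
  have h := hF.comp measurable_consNoise
  rw [← map_consNoise, lintegral_map hF measurable_consNoise, map_consNoise]
  rw [lintegral_prod _ (by exact h.aemeasurable)]
  rw [lintegral_prod _ (by exact h.lintegral_prod_right'.aemeasurable)]

lemma ae_expMeasure_pos : ∀ᵐ a ∂(expMeasure 1), 0 < a := by
  have h : expMeasure 1 (Set.Iic 0) = 0 := by
    rw [expMeasure, gammaMeasure, withDensity_apply _ measurableSet_Iic,
      ← setLIntegral_congr Iio_ae_eq_Iic]
    exact lintegral_gammaPDF_of_nonpos le_rfl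
  rw [ae_iff]
  convert h using 2
  ext a; simp

/-- Almost surely all clock values are positive. -/
lemma ae_noise_pos : ∀ᵐ ω ∂noise, ∀ k, 0 < (ω k).1 := by
  rw [ae_all_iff]
  intro k
  have h1 : ∀ᵐ p ∂((expMeasure 1).prod (volume : Measure unitInterval)), 0 < p.1 :=
    Measure.quasiMeasurePreserving_fst.ae ae_expMeasure_pos
  exact (measurePreserving_eval_infinitePi
    (fun _ : ℕ => (expMeasure 1).prod (volume : Measure unitInterval)) k).quasiMeasurePreserving.ae
      h1

end BirthDeathRates

/-! ### Pathwise decomposition at the first jump. -/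

namespace BirthDeathRates
variable (r : BirthDeathRates)

lemma rate_pos (x : ℕ) : 0 < r.rate x := by
  have h1 := r.birth_pos x
  rcases eq_or_ne x 0 with rfl | hx
  · simpa [rate, r.death_zero] using h1
  · exact add_pos h1 (r.death_pos x hx)

lemma death_nonneg (x : ℕ) : 0 ≤ r.death x := by
  rcases eq_or_ne x 0 with rfl | hx
  · exact r.death_zero.ge
  · exact (r.death_pos x hx).le

/-- The noise after the first step. -/
def shiftNoise (ω : Noise) : Noise := fun k => ω (k + 1)

@[simp] lemma shiftNoise_consNoise (p : (ℝ × unitInterval) × Noise) :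
    shiftNoise (consNoise p) = p.2 := rfl

lemma measurable_shiftNoise : Measurable shiftNoise :=
  measurable_pi_lambda _ fun n => measurable_pi_apply (n + 1)

/-- The first holding time. -/
def firstTime (x : ℕ) (ω : Noise) : ℝ := (ω 0).1 / r.rate x

/-- The state after the first jump. -/
def firstState (x : ℕ) (ω : Noise) : ℕ := r.step x (ω 0).2

lemma chain_succ_eq (x : ℕ) (ω : Noise) (n : ℕ) :
    r.chain x ω (n + 1) = r.chain (r.firstState x ω) (shiftNoise ω) n := by
  induction n with
  | zero => rfl
  | succ n ih =>
    rw [chain, ih]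
    rfl

lemma jumpTime_succ_eq (x : ℕ) (ω : Noise) (n : ℕ) :
    r.jumpTime x ω (n + 1) =
      r.firstTime x ω + r.jumpTime (r.firstState x ω) (shiftNoise ω) n := by
  simp only [jumpTime]
  rw [Finset.sum_range_succ', add_comm]
  congr 1
  refine Finset.sum_congr rfl fun k _ => ?_
  rw [chain_succ_eq]
  rfl

lemma jumpTime_nonneg {ω : Noise} (hω : ∀ k, 0 < (ω k).1) (x n : ℕ) :
    0 ≤ r.jumpTime x ω n :=
  Finset.sum_nonneg fun k _ => (div_pos (hω k) (r.rate_pos _)).le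

lemma monotone_jumpTime {ω : Noise} (hω : ∀ k, 0 < (ω k).1) (x : ℕ) :
    Monotone (r.jumpTime x ω) := by
  refine monotone_nat_of_le_succ fun n => ?_
  simp only [jumpTime]
  rw [Finset.sum_range_succ]
  exact le_add_of_nonneg_right (div_pos (hω n) (r.rate_pos _)).le

lemma process_of_lt {x : ℕ} {ω : Noise} {t : ℝ} (ht : t < r.firstTime x ω) :
    r.process x t ω = x := by
  have h0 : (0 : ℕ) ∈ {n | t < r.jumpTime x ω (n + 1)} := by
    rw [Set.mem_ofPred_eq, jumpTime_succ_eq]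
    simpa [jumpTime] using ht
  rw [process, Nat.sInf_eq_zero.2 (Or.inl h0)]
  rfl

/-- The bound `hn` ensures that `t` precedes some jump time; otherwise the `sInf` would be the
default `0` of the empty set and the process would be sent back to `x`. -/
lemma process_of_ge {x : ℕ} {ω : Noise} {t : ℝ} {n : ℕ} (ht : r.firstTime x ω ≤ t)
    (hn : t < r.jumpTime x ω (n + 1)) :
    r.process x t ω = r.process (r.firstState x ω) (t - r.firstTime x ω) (shiftNoise ω) := by
  have h0 : 0 ∉ {n | t < r.jumpTime x ω (n + 1)} := by
    rw [Set.mem_ofPred_eq, jumpTime_succ_eq]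
    simpa [jumpTime] using ht
  have hpos : 0 < sInf {n | t < r.jumpTime x ω (n + 1)} := by
    rw [Nat.pos_iff_ne_zero, Ne, Nat.sInf_eq_zero]
    rintro (h | h)
    · exact h0 h
    · exact (h ▸ hn : n ∈ (∅ : Set ℕ))
  have h := Nat.sInf_add (n := 1) (p := fun n => t < r.jumpTime x ω (n + 1)) hpos
  rw [process, ← h, chain_succ_eq, process]
  congr 2
  ext m
  rw [Set.mem_ofPred_eq, jumpTime_succ_eq, Set.mem_ofPred_eq, sub_lt_iff_lt_add']

lemma firstTime_pos {ω : Noise} (hω : ∀ k, 0 < (ω k).1) (x : ℕ) : 0 < r.firstTime x ω :=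
  div_pos (hω 0) (r.rate_pos x)

variable (V : ℕ → ℝ) (g : ℕ → ℝ≥0∞)

/-- The integrand of the Feynman-Kac semigroup restricted to at most `n - 1` jumps, defined
recursively through the first jump. -/
def pathFunctional : ℕ → ℝ → ℕ → Noise → ℝ≥0∞
  | 0, _, _, _ => 0
  | n + 1, t, x, ω =>
    if t < r.firstTime x ω then g x * ENNReal.ofReal (Real.exp (-(V x * t)))
    else ENNReal.ofReal (Real.exp (-(V x * r.firstTime x ω))) *
      pathFunctional n (t - r.firstTime x ω) (r.firstState x ω) (shiftNoise ω)

lemma integral_process_of_lt {x : ℕ} {ω : Noise} {t : ℝ} (ht0 : 0 ≤ t)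
    (ht : t < r.firstTime x ω) :
    IntervalIntegrable (fun s => V (r.process x s ω)) volume 0 t ∧
      ∫ s in (0 : ℝ)..t, V (r.process x s ω) = V x * t := by
  have h : Set.EqOn (fun s => V (r.process x s ω)) (fun _ => V x) (Set.uIcc 0 t) := by
    intro s hs
    rw [Set.uIcc_of_le ht0] at hs
    simp only
    rw [r.process_of_lt (hs.2.trans_lt ht)]
  refine ⟨?_, ?_⟩
  · exact (intervalIntegrable_const (c := V x)).congr
      (fun s hs => (h (Set.uIoc_subset_uIcc hs)).symm)
  · rw [intervalIntegral.integral_congr h]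
    simp [mul_comm]

/-- Before the `n`-th jump the path is a finite concatenation of constant pieces, so `V` along it is
integrable whatever `V` is. -/
lemma integral_process {n : ℕ} : ∀ {x : ℕ} {ω : Noise} {t : ℝ}, (∀ k, 0 < (ω k).1) → 0 ≤ t →
    t < r.jumpTime x ω n →
    IntervalIntegrable (fun s => V (r.process x s ω)) volume 0 t ∧
    (r.firstTime x ω ≤ t → ∫ s in (0 : ℝ)..t, V (r.process x s ω) = V x * r.firstTime x ω +
      ∫ s in (0 : ℝ)..(t - r.firstTime x ω),
        V (r.process (r.firstState x ω) s (shiftNoise ω))) := by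
  induction n with
  | zero =>
    intro x ω t hω ht0 ht
    exact absurd ht (by simpa [jumpTime] using ht0)
  | succ n ih =>
    intro x ω t hω ht0 ht
    rcases lt_or_ge t (r.firstTime x ω) with hlt | hge
    · exact ⟨(r.integral_process_of_lt V ht0 hlt).1, fun h => absurd h hlt.not_ge⟩
    set τ := r.firstTime x ω with hτ
    have hτ0 : 0 < τ := r.firstTime_pos hω x
    have hω' : ∀ k, 0 < (shiftNoise ω k).1 := fun k => hω (k + 1)
    have htail : t - τ < r.jumpTime (r.firstState x ω) (shiftNoise ω) n := by
      rw [jumpTime_succ_eq] at ht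
      linarith
    obtain ⟨hI, -⟩ := ih hω' (sub_nonneg.2 hge) htail
    -- The interval must be open on the right: at time `τ` the process has already jumped.
    have e1 : Set.EqOn (fun _ => V x) (fun s => V (r.process x s ω)) (Set.uIoo 0 τ) := by
      intro s hs
      rw [Set.uIoo_of_le hτ0.le] at hs
      simp only
      rw [r.process_of_lt hs.2]
    have e2 : Set.EqOn (fun s => V (r.process (r.firstState x ω) (s - τ) (shiftNoise ω)))
        (fun s => V (r.process x s ω)) (Set.uIcc τ t) := by
      intro s hs
      rw [Set.uIcc_of_le hge] at hs
      simp only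
      rw [r.process_of_ge hs.1 (hs.2.trans_lt ht)]
    have I1 : IntervalIntegrable (fun s => V (r.process x s ω)) volume 0 τ :=
      (intervalIntegrable_const (c := V x)).congr_uIoo e1
    have I2 : IntervalIntegrable (fun s => V (r.process x s ω)) volume τ t := by
      have := hI.comp_sub_right τ
      simp only [zero_add, sub_add_cancel] at this
      exact this.congr fun s hs => e2 (Set.uIoc_subset_uIcc hs)
    refine ⟨I1.trans I2, fun _ => ?_⟩
    rw [← intervalIntegral.integral_add_adjacent_intervals I1 I2,
      ← intervalIntegral.integral_congr_uIoo e1, ← intervalIntegral.integral_congr e2,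
      intervalIntegral.integral_comp_sub_right
        (fun s => V (r.process (r.firstState x ω) s (shiftNoise ω))) τ]
    simp [mul_comm]

/-- Links the two descriptions of the integrand: the recursive one suits integration over the noise,
the explicit one gives monotonicity in `n` and the limit. -/
lemma pathFunctional_eq (n : ℕ) : ∀ {x : ℕ} {ω : Noise} {t : ℝ}, (∀ k, 0 < (ω k).1) → 0 ≤ t →
    r.pathFunctional V g n t x ω = if t < r.jumpTime x ω n then g (r.process x t ω) *
      ENNReal.ofReal (Real.exp (-∫ s in (0 : ℝ)..t, V (r.process x s ω))) else 0 := by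
  induction n with
  | zero =>
    intro x ω t hω ht0
    rw [if_neg (by simpa [jumpTime] using ht0)]
    rfl
  | succ n ih =>
    intro x ω t hω ht0
    have hω' : ∀ k, 0 < (shiftNoise ω k).1 := fun k => hω (k + 1)
    rw [pathFunctional]
    rcases lt_or_ge t (r.firstTime x ω) with hlt | hge
    · have hj : t < r.jumpTime x ω (n + 1) := by
        rw [jumpTime_succ_eq]
        linarith [r.jumpTime_nonneg hω' (r.firstState x ω) n]
      rw [if_pos hlt, if_pos hj, r.process_of_lt hlt, (r.integral_process_of_lt V ht0 hlt).2]
    · rw [if_neg hge.not_gt, ih hω' (sub_nonneg.2 hge)]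
      have hiff : t < r.jumpTime x ω (n + 1) ↔
          t - r.firstTime x ω < r.jumpTime (r.firstState x ω) (shiftNoise ω) n := by
        rw [jumpTime_succ_eq, sub_lt_iff_lt_add']
      by_cases hj : t < r.jumpTime x ω (n + 1)
      · rw [if_pos (hiff.1 hj), if_pos hj, r.process_of_ge hge hj,
          (r.integral_process V hω ht0 hj).2 hge, neg_add, Real.exp_add,
          ENNReal.ofReal_mul (Real.exp_pos _).le]
        ring
      · rw [if_neg (hiff.not.1 hj), if_neg hj, mul_zero]

lemma measurable_step (x : ℕ) : Measurable (r.step x) := by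
  unfold step
  refine Measurable.ite ?_ measurable_const measurable_const
  exact measurableSet_le (measurable_subtype_coe.mul_const _) measurable_const

lemma measurable_firstTime (x : ℕ) : Measurable (r.firstTime x) :=
  ((measurable_fst.comp (measurable_pi_apply 0)).div_const _)

lemma measurable_firstState (x : ℕ) : Measurable (r.firstState x) :=
  (r.measurable_step x).comp (measurable_snd.comp (measurable_pi_apply 0))

/-- Joint measurability in time and noise is what the induction needs, since the recursive call is
made at the random time `t - firstTime`. The random state is harmless because `ℕ` is countable. -/
lemma measurable_pathFunctional (n x : ℕ) :
    Measurable fun p : ℝ × Noise => r.pathFunctional V g n p.1 x p.2 := by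
  induction n generalizing x with
  | zero => exact measurable_const
  | succ n ih =>
    simp only [pathFunctional]
    have hT : Measurable fun p : ℝ × Noise => r.firstTime x p.2 :=
      (r.measurable_firstTime x).comp measurable_snd
    have hS : Measurable fun p : ℝ × Noise => r.firstState x p.2 :=
      (r.measurable_firstState x).comp measurable_snd
    refine Measurable.ite (measurableSet_lt measurable_fst hT) ?_ ?_
    · fun_prop
    · refine Measurable.mul (by fun_prop) ?_
      have h1 : Measurable fun q : ℕ × (ℝ × Noise) =>
          r.pathFunctional V g n q.2.1 q.1 q.2.2 :=
        measurable_from_prod_countable_right fun y => ih y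
      exact h1.comp (hS.prodMk ((measurable_fst.sub hT).prodMk
        (measurable_shiftNoise.comp measurable_snd)))

end BirthDeathRates

/-! ### The first-jump integral equation of the Feynman-Kac semigroup. -/

namespace BirthDeathRates
variable (r : BirthDeathRates)

lemma lintegral_step (x : ℕ) (H : ℕ → ℝ≥0∞) :
    ∫⁻ u, H (r.step x u) = ENNReal.ofReal (r.birth x / r.rate x) * H (x + 1) +
      ENNReal.ofReal (r.death x / r.rate x) * H (x - 1) := by
  have hq := r.rate_pos x
  have hb : r.birth x / r.rate x ∈ Set.Icc (0 : ℝ) 1 :=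
    ⟨(div_pos (r.birth_pos x) hq).le, (div_le_one hq).2 (by
      rw [rate]; linarith [r.death_nonneg x])⟩
  set p : unitInterval := ⟨r.birth x / r.rate x, hb⟩ with hp
  have hstep : ∀ u, H (r.step x u) = (Set.Iic p).indicator (fun _ => H (x + 1)) u +
      (Set.Ioi p).indicator (fun _ => H (x - 1)) u := by
    intro u
    have hiff : (u : ℝ) * r.rate x ≤ r.birth x ↔ u ≤ p := by
      rw [← le_div_iff₀ hq]
      rfl
    by_cases hu : u ≤ p
    · simp [step, hiff, hu]
    · simp [step, hiff, hu, not_le.1 hu]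
  simp_rw [hstep]
  rw [lintegral_add_left (measurable_const.indicator measurableSet_Iic),
    lintegral_indicator_const measurableSet_Iic, lintegral_indicator_const measurableSet_Ioi,
    unitInterval.volume_Iic, unitInterval.volume_Ioi, mul_comm, mul_comm (H (x - 1))]
  congr 3
  rw [hp, eq_div_iff hq.ne', sub_mul, div_mul_cancel₀ _ hq.ne', rate]
  ring

lemma lintegral_expMeasure {F : ℝ → ℝ≥0∞} (hF : Measurable F) :
    ∫⁻ a, F a ∂(expMeasure 1) = ∫⁻ a in Set.Ioi 0, ENNReal.ofReal (Real.exp (-a)) * F a := by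
  rw [expMeasure, gammaMeasure,
    lintegral_withDensity_eq_lintegral_mul _
      (by exact (measurable_exponentialPDFReal 1).ennreal_ofReal) hF,
    setLIntegral_congr Ioi_ae_eq_Ici, ← lintegral_indicator measurableSet_Ici]
  refine lintegral_congr fun a => ?_
  have h := exponentialPDF_eq 1 a
  simp only [exponentialPDF, exponentialPDFReal] at h
  simp only [Pi.mul_apply, gammaPDF]
  rw [h]
  by_cases ha : 0 ≤ a <;> simp [ha]

lemma lintegral_expMeasure_Ioi (q t : ℝ) (c : ℝ≥0∞) :
    ∫⁻ a in Set.Ioi (q * t), ENNReal.ofReal (Real.exp (-a)) * c =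
      ENNReal.ofReal (Real.exp (-(q * t))) * c := by
  rw [lintegral_mul_const _ (by fun_prop),
    ← ofReal_integral_eq_lintegral_ofReal (integrableOn_exp_neg_Ioi _)
      (ae_of_all _ fun a => (Real.exp_pos _).le), integral_exp_neg_Ioi]

/-- Changes from the clock value `a = q * (t - u)` to the time `u` left after the jump. -/
lemma lintegral_Ioc_mul_sub {q : ℝ} (hq : 0 < q) (t : ℝ) (F : ℝ → ℝ≥0∞) :
    ∫⁻ a in Set.Ioc 0 (q * t), F a = ∫⁻ u in Set.Ioc 0 t, ENNReal.ofReal q * F (q * (t - u)) := by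
  have himg : (fun u => q * (t - u)) '' Set.Ico 0 t = Set.Ioc 0 (q * t) := by
    ext a
    simp only [Set.mem_image, Set.mem_Ico, Set.mem_Ioc]
    constructor
    · rintro ⟨u, ⟨h0, h1⟩, rfl⟩
      exact ⟨mul_pos hq (sub_pos.2 h1), by nlinarith⟩
    · rintro ⟨h0, h1⟩
      refine ⟨t - a / q, ⟨?_, ?_⟩, ?_⟩
      · rw [sub_nonneg, div_le_iff₀ hq]; linarith
      · linarith [div_pos h0 hq]
      · field_simp; ring
  have hd : ∀ u ∈ Set.Ico 0 t, HasDerivWithinAt (fun u => q * (t - u)) (-q) (Set.Ico 0 t) u := by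
    intro u _
    have := ((hasDerivAt_id u).const_sub t).const_mul q
    simpa using this.hasDerivWithinAt
  have hinj : Set.InjOn (fun u => q * (t - u)) (Set.Ico 0 t) := by
    intro u _ v _ huv
    have := mul_left_cancel₀ hq.ne' huv
    linarith
  rw [← himg, lintegral_image_eq_lintegral_abs_deriv_mul measurableSet_Ico hd hinj,
    setLIntegral_congr Ico_ae_eq_Ioc, abs_neg, abs_of_pos hq]

/-- The integral over the first jump in the first-jump decomposition: the path stays at `x`, being
killed at rate `k x - rate x`, for a time `t - u`, then jumps, and `u` is the remaining time. -/
def jumpIntegral (k : ℕ → ℝ) (F : ℝ → ℕ → ℝ≥0∞) (t : ℝ) (x : ℕ) : ℝ≥0∞ :=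
  ∫⁻ u in Set.Ioc 0 t, ENNReal.ofReal (Real.exp (-(k x * (t - u)))) *
    (ENNReal.ofReal (r.birth x) * F u (x + 1) + ENNReal.ofReal (r.death x) * F u (x - 1))

variable (V : ℕ → ℝ) (g : ℕ → ℝ≥0∞)

/-- The Feynman-Kac semigroup restricted to paths with at most `n - 1` jumps. -/
def feynmanKacApprox (n : ℕ) (t : ℝ) (x : ℕ) : ℝ≥0∞ := ∫⁻ ω, r.pathFunctional V g n t x ω ∂noise

lemma measurable_feynmanKacApprox (n x : ℕ) :
    Measurable fun t => r.feynmanKacApprox V g n t x :=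
  (r.measurable_pathFunctional V g n x).lintegral_prod_right'

lemma feynmanKacApprox_zero : r.feynmanKacApprox V g 0 = 0 := by
  funext t x
  simp [feynmanKacApprox, pathFunctional]

/-- Integrate out the first clock `a`. If `a > q * t` there is no jump, which has probability `exp
(-(q * t))`. Otherwise the Jacobian `q` of the substitution cancels the denominators of the jump
probabilities `λ_x / q` and `ν_x / q`. -/
lemma feynmanKacApprox_succ (n : ℕ) {t : ℝ} (ht : 0 ≤ t) (x : ℕ) :
    r.feynmanKacApprox V g (n + 1) t x =
      ENNReal.ofReal (Real.exp (-((r.rate x + V x) * t))) * g x +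
        r.jumpIntegral (fun y => r.rate y + V y) (r.feynmanKacApprox V g n) t x := by
  have hq := r.rate_pos x
  set q := r.rate x with hqdef
  have hm : Measurable fun ω => r.pathFunctional V g (n + 1) t x ω :=
    (r.measurable_pathFunctional V g (n + 1) x).comp measurable_prodMk_left
  have hGm := r.measurable_feynmanKacApprox V g n
  set G := r.feynmanKacApprox V g n with hG
  have hinner : ∀ a, (∫⁻ u : unitInterval, ∫⁻ ω, r.pathFunctional V g (n + 1) t x
        (consNoise ((a, u), ω)) ∂noise ∂volume) =
      if t < a / q then g x * ENNReal.ofReal (Real.exp (-(V x * t)))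
      else ENNReal.ofReal (Real.exp (-(V x * (a / q)))) *
        (ENNReal.ofReal (r.birth x / q) * G (t - a / q) (x + 1) +
          ENNReal.ofReal (r.death x / q) * G (t - a / q) (x - 1)) := by
    intro a
    simp only [pathFunctional, firstTime, firstState, consNoise_zero, shiftNoise_consNoise,
      ← hqdef]
    split_ifs with h
    · simp
    · rw [← r.lintegral_step x (fun y => G (t - a / q) y), ← lintegral_const_mul]
      · refine lintegral_congr fun u => ?_
        rw [lintegral_const_mul]
        · rfl
        · exact (r.measurable_pathFunctional V g n _).comp measurable_prodMk_left
      · exact (measurable_from_nat (f := fun y => G (t - a / q) y)).comp (r.measurable_step x)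
  rw [feynmanKacApprox, lintegral_noise_eq hm]
  simp_rw [hinner]
  rw [lintegral_expMeasure]
  swap
  · refine Measurable.ite (measurableSet_lt measurable_const (by fun_prop)) measurable_const ?_
    have h1 := (hGm (x + 1)).comp (g := fun s => G s (x + 1)) (f := fun a : ℝ => t - a / q)
      (by fun_prop)
    have h2 := (hGm (x - 1)).comp (g := fun s => G s (x - 1)) (f := fun a : ℝ => t - a / q)
      (by fun_prop)
    simp only [Function.comp_def] at h1 h2
    fun_prop
  have hqt : 0 ≤ q * t := mul_nonneg hq.le ht
  rw [← Set.Ioc_union_Ioi_eq_Ioi hqt, lintegral_union measurableSet_Ioi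
    (Set.Ioc_disjoint_Ioi le_rfl), add_comm]
  congr 1
  · rw [setLIntegral_congr_fun (g := fun a => ENNReal.ofReal (Real.exp (-a)) *
      (g x * ENNReal.ofReal (Real.exp (-(V x * t))))) measurableSet_Ioi]
    · rw [lintegral_expMeasure_Ioi q t, mul_comm (g x), ← mul_assoc,
        ← ENNReal.ofReal_mul (Real.exp_pos _).le, ← Real.exp_add]
      congr 3
      ring_nf
    · intro a ha
      simp only
      rw [if_pos]
      rw [lt_div_iff₀ hq, mul_comm]
      exact ha
  · rw [lintegral_Ioc_mul_sub hq t, jumpIntegral]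
    refine setLIntegral_congr_fun measurableSet_Ioc fun u hu => ?_
    have e : q * (t - u) / q = t - u := by field_simp
    rw [e, if_neg (by linarith [hu.1]), sub_sub_cancel, ← mul_assoc, ← mul_assoc, mul_comm _
      (ENNReal.ofReal (Real.exp (-(V x * (t - u))))), mul_comm (ENNReal.ofReal q), ← mul_assoc,
      ← ENNReal.ofReal_mul (Real.exp_pos _).le, ← Real.exp_add, mul_assoc]
    congr 1
    · congr 2
      ring
    · rw [mul_add, ← mul_assoc, ← mul_assoc, ← ENNReal.ofReal_mul hq.le,
        ← ENNReal.ofReal_mul hq.le, mul_div_cancel₀ _ hq.ne', mul_div_cancel₀ _ hq.ne']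

lemma pathFunctional_le_succ {n : ℕ} {x : ℕ} {ω : Noise} {t : ℝ} (hω : ∀ k, 0 < (ω k).1)
    (ht : 0 ≤ t) : r.pathFunctional V g n t x ω ≤ r.pathFunctional V g (n + 1) t x ω := by
  rw [pathFunctional_eq _ _ _ _ hω ht, pathFunctional_eq _ _ _ _ hω ht]
  split_ifs with h1 h2
  · exact le_rfl
  · exact absurd (h1.trans_le (r.monotone_jumpTime hω x n.le_succ)) h2
  · exact zero_le
  · exact le_rfl

lemma measurable_chain (x n : ℕ) : Measurable fun ω => r.chain x ω n := by
  induction n with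
  | zero => exact measurable_const
  | succ n ih =>
    have h1 : Measurable fun q : ℕ × unitInterval => r.step q.1 q.2 :=
      measurable_from_prod_countable_right fun y => r.measurable_step y
    exact h1.comp (ih.prodMk (measurable_snd.comp (measurable_pi_apply n)))

lemma measurable_jumpTime (x n : ℕ) : Measurable fun ω => r.jumpTime x ω n := by
  refine Finset.measurable_fun_sum _ fun k _ => ?_
  have : Measurable fun ω => r.rate (r.chain x ω k) :=
    (measurable_from_nat (f := r.rate)).comp (r.measurable_chain x k)
  exact (measurable_fst.comp (measurable_pi_apply k)).div this

lemma measurableSet_alive (x : ℕ) (t : ℝ) : MeasurableSet (r.alive x t) := by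
  simp only [alive, Set.ofPred_exists]
  exact MeasurableSet.iUnion fun n => measurableSet_lt measurable_const (r.measurable_jumpTime x n)

/-- Monotone convergence: up to a null set, `alive` is the increasing union of the events that `t`
precedes the `n`-th jump. Non-explosion plays no role. -/
lemma feynmanKac_eq_iSup {t : ℝ} (ht : 0 ≤ t) (x : ℕ) :
    r.feynmanKac V t g x = ⨆ n, r.feynmanKacApprox V g n t x := by
  have hm : ∀ n, Measurable fun ω => r.pathFunctional V g n t x ω := fun n =>
    (r.measurable_pathFunctional V g n x).comp measurable_prodMk_left
  simp only [feynmanKacApprox]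
  rw [feynmanKac, ← lintegral_indicator (r.measurableSet_alive x t),
    ← lintegral_iSup_ae (fun n => hm n)]
  · refine lintegral_congr_ae ?_
    filter_upwards [ae_noise_pos] with ω hω
    simp_rw [pathFunctional_eq _ _ _ _ hω ht]
    by_cases h : ∃ n, t < r.jumpTime x ω n
    · rw [Set.indicator_of_mem (by exact h)]
      obtain ⟨n, hn⟩ := h
      refine le_antisymm (le_iSup_of_le n (by rw [if_pos hn])) (iSup_le fun m => ?_)
      split_ifs
      · exact le_rfl
      · exact zero_le
    · rw [Set.indicator_of_notMem (by exact h)]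
      push Not at h
      simp [not_lt.2 (h _)]
  · intro n
    filter_upwards [ae_noise_pos] with ω hω
    exact r.pathFunctional_le_succ V g hω ht

lemma feynmanKacApprox_le_succ {t : ℝ} (ht : 0 ≤ t) (n x : ℕ) :
    r.feynmanKacApprox V g n t x ≤ r.feynmanKacApprox V g (n + 1) t x := by
  refine lintegral_mono_ae ?_
  filter_upwards [ae_noise_pos] with ω hω
  exact r.pathFunctional_le_succ V g hω ht

/-- First-jump decomposition of the Feynman-Kac semigroup. -/
lemma feynmanKac_eq {t : ℝ} (ht : 0 ≤ t) (x : ℕ) :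
    r.feynmanKac V t g x = ENNReal.ofReal (Real.exp (-((r.rate x + V x) * t))) * g x +
      r.jumpIntegral (fun y => r.rate y + V y) (fun u y => r.feynmanKac V u g y) t x := by
  have hmono : ∀ {u : ℝ}, 0 ≤ u → ∀ y, Monotone fun n => r.feynmanKacApprox V g n u y :=
    fun hu y => monotone_nat_of_le_succ fun n => r.feynmanKacApprox_le_succ V g hu n y
  have hm := r.measurable_feynmanKacApprox V g
  rw [r.feynmanKac_eq_iSup V g ht, ← (hmono ht x).iSup_nat_add 1]
  simp_rw [r.feynmanKacApprox_succ V g _ ht]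
  rw [← ENNReal.add_iSup]
  congr 1
  simp only [jumpIntegral]
  rw [← lintegral_iSup_ae]
  · refine setLIntegral_congr_fun measurableSet_Ioc fun u hu => ?_
    rw [r.feynmanKac_eq_iSup V g hu.1.le, r.feynmanKac_eq_iSup V g hu.1.le, ENNReal.mul_iSup,
      ENNReal.mul_iSup, ENNReal.iSup_add_iSup_of_monotone, ENNReal.mul_iSup]
    · exact fun a b h => mul_le_mul_right (hmono hu.1.le _ h) _
    · exact fun a b h => mul_le_mul_right (hmono hu.1.le _ h) _
  · intro n
    have := hm n (x + 1)
    have := hm n (x - 1)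
    fun_prop
  · intro n
    filter_upwards [ae_restrict_mem measurableSet_Ioc] with u hu
    gcongr
    · exact r.feynmanKacApprox_le_succ V g hu.1.le n _
    · exact r.feynmanKacApprox_le_succ V g hu.1.le n _

/-- The supremum formula is established for `t ≥ 0` only, so measurability in time is obtained
through a version that agrees there. -/
lemma exists_measurable_feynmanKac (x : ℕ) :
    ∃ F : ℝ → ℝ≥0∞, Measurable F ∧ ∀ t, 0 ≤ t → r.feynmanKac V t g x = F t :=
  ⟨fun t => ⨆ n, r.feynmanKacApprox V g n t x,
    Measurable.iSup fun n => r.measurable_feynmanKacApprox V g n x,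
    fun _ ht => r.feynmanKac_eq_iSup V g ht x⟩

end BirthDeathRates

/-! ### Lyapunov bounds and the comparison principle. -/

namespace BirthDeathRates
variable (r : BirthDeathRates)

lemma jumpIntegral_mono (k : ℕ → ℝ) {F G : ℝ → ℕ → ℝ≥0∞} {t : ℝ} (x : ℕ)
    (h : ∀ u ∈ Set.Ioc 0 t, ∀ y, F u y ≤ G u y) :
    r.jumpIntegral k F t x ≤ r.jumpIntegral k G t x := by
  refine setLIntegral_mono' measurableSet_Ioc fun u hu => ?_
  gcongr
  · exact h u hu _
  · exact h u hu _

lemma jumpIntegral_add (k : ℕ → ℝ) (F : ℝ → ℕ → ℝ≥0∞) {G : ℝ → ℕ → ℝ≥0∞}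
    (hG : ∀ y, Measurable fun u => G u y) (t : ℝ) (x : ℕ) :
    r.jumpIntegral k (fun u y => F u y + G u y) t x =
      r.jumpIntegral k F t x + r.jumpIntegral k G t x := by
  have h1 := hG (x + 1)
  have h2 := hG (x - 1)
  simp only [jumpIntegral]
  rw [← lintegral_add_right _ (by fun_prop)]
  refine lintegral_congr fun u => ?_
  ring

/-- If `ψ` satisfies `Lψ ≤ K ψ`, then `exp (K t) ψ` dominates its first-jump decomposition. -/
lemma jumpIntegral_lyapunov {k : ℕ → ℝ} {K : ℝ} {ψ : ℕ → ℝ} (hψ : ∀ x, 0 ≤ ψ x)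
    (x : ℕ) (hL : r.birth x * ψ (x + 1) + r.death x * ψ (x - 1) ≤ (k x + K) * ψ x)
    {t : ℝ} (ht : 0 ≤ t) :
    ENNReal.ofReal (Real.exp (-(k x * t))) * ENNReal.ofReal (ψ x) +
      r.jumpIntegral k (fun u y => ENNReal.ofReal (Real.exp (K * u) * ψ y)) t x ≤
    ENNReal.ofReal (Real.exp (K * t) * ψ x) := by
  have hb := (r.birth_pos x).le
  have hd := r.death_nonneg x
  set c : ℝ := Real.exp (-(k x * t)) * ((k x + K) * ψ x) with hc
  have hpt : ∀ u : ℝ, Real.exp (-(k x * (t - u))) * (r.birth x * (Real.exp (K * u) * ψ (x + 1)) +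
      r.death x * (Real.exp (K * u) * ψ (x - 1))) ≤ c * Real.exp ((k x + K) * u) := by
    intro u
    have e : c * Real.exp ((k x + K) * u) =
        Real.exp (-(k x * (t - u))) * (Real.exp (K * u) * ((k x + K) * ψ x)) := by
      rw [hc, mul_right_comm, ← Real.exp_add,
        ← mul_assoc (Real.exp (-(k x * (t - u)))), ← Real.exp_add]
      congr 2
      ring
    rw [e]
    refine mul_le_mul_of_nonneg_left ?_ (Real.exp_pos _).le
    refine le_trans (le_of_eq ?_) (mul_le_mul_of_nonneg_left hL (Real.exp_pos (K * u)).le)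
    ring
  have hcnn : 0 ≤ c := by
    refine mul_nonneg (Real.exp_pos _).le (le_trans ?_ hL)
    have := hψ (x + 1)
    have := hψ (x - 1)
    positivity
  have hint : IntervalIntegrable (fun u => c * Real.exp ((k x + K) * u)) volume 0 t :=
    Continuous.intervalIntegrable (by fun_prop) _ _
  have hle : r.jumpIntegral k (fun u y => ENNReal.ofReal (Real.exp (K * u) * ψ y)) t x ≤
      ENNReal.ofReal (∫ u in (0 : ℝ)..t, c * Real.exp ((k x + K) * u)) := by
    rw [intervalIntegral.integral_of_le ht, ofReal_integral_eq_lintegral_ofReal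
      ((intervalIntegrable_iff_integrableOn_Ioc_of_le ht).1 hint)
      (ae_of_all _ fun u => mul_nonneg hcnn (Real.exp_pos _).le)]
    refine lintegral_mono fun u => ?_
    have h1 : 0 ≤ Real.exp (K * u) * ψ (x + 1) := mul_nonneg (Real.exp_pos _).le (hψ _)
    have h2 : 0 ≤ Real.exp (K * u) * ψ (x - 1) := mul_nonneg (Real.exp_pos _).le (hψ _)
    simp only
    rw [← ENNReal.ofReal_mul hb, ← ENNReal.ofReal_mul hd, ← ENNReal.ofReal_add
      (mul_nonneg hb h1) (mul_nonneg hd h2), ← ENNReal.ofReal_mul (Real.exp_pos _).le]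
    exact ENNReal.ofReal_le_ofReal (hpt u)
  have hval : ∫ u in (0 : ℝ)..t, c * Real.exp ((k x + K) * u) =
      Real.exp (K * t) * ψ x - Real.exp (-(k x * t)) * ψ x := by
    -- This primitive produces the factor `k x + K` by differentiation, so the case `k x + K = 0`
    -- needs no separate treatment.
    have hder : ∀ u ∈ Set.uIcc 0 t, HasDerivAt
        (fun u => Real.exp (-(k x * t)) * ψ x * Real.exp ((k x + K) * u))
        (c * Real.exp ((k x + K) * u)) u := by
      intro u _
      refine ((((hasDerivAt_id u).const_mul (k x + K)).exp).const_mul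
        (Real.exp (-(k x * t)) * ψ x)).congr_deriv ?_
      simp only [hc, id]
      ring
    rw [intervalIntegral.integral_eq_sub_of_hasDerivAt hder hint, mul_zero, Real.exp_zero,
      mul_one, mul_right_comm, ← Real.exp_add]
    congr 3
    ring
  have h0 : 0 ≤ Real.exp (-(k x * t)) * ψ x := mul_nonneg (Real.exp_pos _).le (hψ x)
  have hnn : 0 ≤ ∫ u in (0 : ℝ)..t, c * Real.exp ((k x + K) * u) :=
    intervalIntegral.integral_nonneg ht fun u _ => mul_nonneg hcnn (Real.exp_pos _).le
  calc _ ≤ ENNReal.ofReal (Real.exp (-(k x * t)) * ψ x) +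
        ENNReal.ofReal (∫ u in (0 : ℝ)..t, c * Real.exp ((k x + K) * u)) := by
        rw [ENNReal.ofReal_mul (Real.exp_pos _).le]
        gcongr
    _ = _ := by
        rw [← ENNReal.ofReal_add h0 hnn, hval]
        congr 1
        ring

lemma jumpIntegral_one_le {k : ℕ → ℝ} (x : ℕ) (hk : r.rate x ≤ k x) {t : ℝ} (ht : 0 ≤ t) :
    r.jumpIntegral k (fun _ _ => 1) t x ≤ ENNReal.ofReal (1 - Real.exp (-(k x * t))) := by
  have h := r.jumpIntegral_lyapunov (k := k) (K := 0) (ψ := fun _ => 1) (fun _ => zero_le_one) x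
    (by simpa [rate] using hk) ht
  simp only [zero_mul, Real.exp_zero, mul_one, ENNReal.ofReal_one] at h
  rw [ENNReal.ofReal_sub _ (Real.exp_pos _).le, ENNReal.ofReal_one]
  exact ENNReal.le_sub_of_add_le_left ENNReal.ofReal_ne_top h

lemma jumpIntegral_const_mul (k : ℕ → ℝ) {c : ℝ≥0∞} (hc : c ≠ ∞) (F : ℝ → ℕ → ℝ≥0∞)
    (t : ℝ) (x : ℕ) :
    r.jumpIntegral k (fun u y => c * F u y) t x = c * r.jumpIntegral k F t x := by
  simp only [jumpIntegral]
  rw [← lintegral_const_mul' _ _ hc]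
  refine lintegral_congr fun u => ?_
  ring

lemma lyapunov_linear {Λ : ℝ} (hΛ : ∀ x, r.birth x ≤ Λ) {k : ℕ → ℝ} (hk : ∀ x, r.rate x ≤ k x)
    (x : ℕ) : r.birth x * (1 + ((x + 1 : ℕ) : ℝ)) + r.death x * (1 + ((x - 1 : ℕ) : ℝ)) ≤
      (k x + Λ) * (1 + (x : ℝ)) := by
  have hb := r.birth_pos x
  have hd := r.death_nonneg x
  have h1 := hΛ x
  have h2 := hk x
  rw [rate] at h2
  have h3 : r.death x * (1 + ((x - 1 : ℕ) : ℝ)) ≤ r.death x * (1 + (x : ℝ)) := by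
    gcongr
    exact Nat.sub_le _ _
  have hx : (0 : ℝ) ≤ x := Nat.cast_nonneg x
  push_cast
  nlinarith

lemma lyapunov_quadratic {Λ : ℝ} (hΛ : ∀ x, r.birth x ≤ Λ) {k : ℕ → ℝ}
    (hk : ∀ x, r.rate x ≤ k x) (x : ℕ) :
    r.birth x * (1 + ((x + 1 : ℕ) : ℝ)) ^ 2 + r.death x * (1 + ((x - 1 : ℕ) : ℝ)) ^ 2 ≤
      (k x + 3 * Λ) * (1 + (x : ℝ)) ^ 2 := by
  have hb := r.birth_pos x
  have hd := r.death_nonneg x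
  have h1 := hΛ x
  have h2 := hk x
  rw [rate] at h2
  have h3 : r.death x * (1 + ((x - 1 : ℕ) : ℝ)) ^ 2 ≤ r.death x * (1 + (x : ℝ)) ^ 2 := by
    gcongr
    exact Nat.sub_le _ _
  have hx : (0 : ℝ) ≤ x := Nat.cast_nonneg x
  -- Here `2 * x + 3 = (2 + x) ^ 2 - (1 + x) ^ 2` is the gain of the Lyapunov function at a birth;
  -- this is the source of the constant `3 * Λ`.
  have h4 : r.birth x * (2 * x + 3) ≤ 3 * Λ * (1 + (x : ℝ)) ^ 2 := by
    have : (2 * x + 3 : ℝ) ≤ 3 * (1 + (x : ℝ)) ^ 2 := by nlinarith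
    calc r.birth x * (2 * x + 3) ≤ Λ * (3 * (1 + (x : ℝ)) ^ 2) := by gcongr; linarith
      _ = _ := by ring
  have h5 : (r.birth x + r.death x) * (1 + (x : ℝ)) ^ 2 ≤ k x * (1 + (x : ℝ)) ^ 2 := by gcongr
  push_cast
  nlinarith

/-- The bound is a supersolution of the first-jump equation, so it passes through the induction on
the number of jumps. -/
lemma feynmanKac_le_linear {Λ : ℝ} (hΛ : ∀ x, r.birth x ≤ Λ) {V : ℕ → ℝ} (hV : ∀ x, 0 ≤ V x)
    {g : ℕ → ℝ≥0∞} {C : ℝ} (hC : 0 ≤ C) (hg : ∀ x : ℕ, g x ≤ ENNReal.ofReal (C * (1 + x)))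
    {t : ℝ} (ht : 0 ≤ t) (x : ℕ) :
    r.feynmanKac V t g x ≤ ENNReal.ofReal (Real.exp (Λ * t) * (C * (1 + x))) := by
  rw [r.feynmanKac_eq_iSup V g ht]
  refine iSup_le fun n => ?_
  induction n generalizing t x with
  | zero => simp [feynmanKacApprox_zero]
  | succ n ih =>
    have hL : r.birth x * (C * (1 + ((x + 1 : ℕ) : ℝ))) +
        r.death x * (C * (1 + ((x - 1 : ℕ) : ℝ))) ≤ (r.rate x + V x + Λ) * (C * (1 + (x : ℝ))) := by
      have := mul_le_mul_of_nonneg_left (r.lyapunov_linear hΛ (k := fun y => r.rate y + V y)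
        (fun y => le_add_of_nonneg_right (hV y)) x) hC
      linarith
    rw [r.feynmanKacApprox_succ V g n ht]
    refine le_trans ?_ (r.jumpIntegral_lyapunov (k := fun y => r.rate y + V y) (K := Λ)
      (ψ := fun y => C * (1 + (y : ℝ))) (fun y => by positivity) x hL ht)
    gcongr
    · exact hg x
    · exact r.jumpIntegral_mono _ x fun u hu y => ih hu.1.le y

/-- Comparison principle: a function of at most linear growth that is dominated by its own
jump integral vanishes. -/
lemma eq_zero_of_le_jumpIntegral {Λ : ℝ} (hΛ : ∀ x, r.birth x ≤ Λ) {k : ℕ → ℝ}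
    (hk : ∀ x, r.rate x ≤ k x) {T C : ℝ} {D : ℝ → ℕ → ℝ≥0∞}
    (hD : ∀ t ∈ Set.Icc 0 T, ∀ x, D t x ≤ r.jumpIntegral k D t x)
    (hC : ∀ t ∈ Set.Icc 0 T, ∀ x : ℕ, D t x ≤ ENNReal.ofReal (C * (1 + x)))
    {t : ℝ} (ht : t ∈ Set.Icc 0 T) (x : ℕ) : D t x = 0 := by
  have hΛ0 : 0 ≤ Λ := (r.birth_pos 0).le.trans (hΛ 0)
  have key : ∀ ε > 0, D t x ≤ ENNReal.ofReal (ε * (Real.exp (3 * Λ * t) * (1 + (x : ℝ)) ^ 2)) := by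
    -- The killing rates `k` may be unbounded, so there is no direct contraction in sup norm.
    -- Subtracting a small quadratic supersolution `Ψ` with truncation leaves an `E` supported on `y
    -- < N`, because `D` grows at most linearly.
    intro ε hε
    set Ψ : ℝ → ℕ → ℝ≥0∞ := fun u y =>
      ENNReal.ofReal (Real.exp (3 * Λ * u) * (ε * (1 + (y : ℝ)) ^ 2)) with hΨ
    have hΨm : ∀ y, Measurable fun u => Ψ u y := fun y => by
      simp only [hΨ]
      fun_prop
    set E : ℝ → ℕ → ℝ≥0∞ := fun u y => D u y - Ψ u y with hE
    have hEJ : ∀ s ∈ Set.Icc 0 T, ∀ y, E s y ≤ r.jumpIntegral k E s y := by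
      intro s hs y
      rw [hE, tsub_le_iff_right]
      calc D s y ≤ r.jumpIntegral k D s y := hD s hs y
        _ ≤ r.jumpIntegral k (fun u z => E u z + Ψ u z) s y :=
          r.jumpIntegral_mono k y fun u _ z => le_tsub_add
        _ = r.jumpIntegral k E s y + r.jumpIntegral k Ψ s y := r.jumpIntegral_add k E hΨm s y
        _ ≤ r.jumpIntegral k E s y + Ψ s y := by
          gcongr
          refine le_trans le_add_self (r.jumpIntegral_lyapunov (k := k) (K := 3 * Λ)
            (ψ := fun z => ε * (1 + (z : ℝ)) ^ 2) (fun z => by positivity) y ?_ hs.1)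
          have := mul_le_mul_of_nonneg_left (r.lyapunov_quadratic hΛ hk y) hε.le
          linarith
    obtain ⟨N, hN⟩ := exists_nat_ge (C / ε)
    have hEN : ∀ s ∈ Set.Icc 0 T, ∀ y ≥ N, E s y = 0 := by
      intro s hs y hy
      refine tsub_eq_zero_of_le ((hC s hs y).trans (ENNReal.ofReal_le_ofReal ?_))
      have h1 : C ≤ ε * (1 + (y : ℝ)) := by
        rw [div_le_iff₀ hε] at hN
        have : (N : ℝ) ≤ y := by exact_mod_cast hy
        nlinarith
      have h2 : (1 : ℝ) ≤ Real.exp (3 * Λ * s) := by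
        rw [Real.one_le_exp_iff]
        have := hs.1
        positivity
      calc C * (1 + (y : ℝ)) ≤ ε * (1 + (y : ℝ)) * (1 + y) := by gcongr
        _ = 1 * (ε * (1 + (y : ℝ)) ^ 2) := by ring
        _ ≤ _ := by gcongr
    obtain ⟨κ, hκ⟩ : ∃ κ, ∀ y < N, k y ≤ κ := by
      obtain ⟨κ, hκ⟩ := ((Finset.range N).image k).bddAbove
      exact ⟨κ, fun y hy => hκ (by simpa using ⟨y, hy, rfl⟩)⟩
    set M : ℝ≥0∞ := ⨆ s ∈ Set.Icc 0 T, ⨆ y, E s y with hM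
    have hEM : ∀ s ∈ Set.Icc 0 T, ∀ y, E s y ≤ M := fun s hs y =>
      le_trans (le_iSup (E s) y) (le_iSup₂ (f := fun s (_ : s ∈ Set.Icc 0 T) => ⨆ y, E s y) s hs)
    have hMtop : M ≠ ∞ := by
      have : M ≤ ENNReal.ofReal (|C| * (1 + N)) := by
        refine iSup₂_le fun s hs => iSup_le fun y => ?_
        rcases lt_or_ge y N with hy | hy
        · refine tsub_le_self.trans ((hC s hs y).trans (ENNReal.ofReal_le_ofReal ?_))
          have : (y : ℝ) ≤ N := by exact_mod_cast hy.le
          calc C * (1 + (y : ℝ)) ≤ |C| * (1 + (y : ℝ)) := by gcongr; exact le_abs_self C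
            _ ≤ _ := by gcongr
        · rw [hEN s hs y hy]
          exact zero_le
      exact ne_top_of_le_ne_top ENNReal.ofReal_ne_top this
    -- On the finitely many relevant sites `k ≤ κ`, so the jump integral contracts the finite
    -- supremum `M` by a factor below `1`, which forces `M = 0`.
    have hMle : M ≤ M * ENNReal.ofReal (1 - Real.exp (-(|κ| * T))) := by
      refine iSup₂_le fun s hs => iSup_le fun y => ?_
      rcases lt_or_ge y N with hy | hy
      · calc E s y ≤ r.jumpIntegral k E s y := hEJ s hs y
          _ ≤ r.jumpIntegral k (fun _ _ => M * 1) s y :=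
            r.jumpIntegral_mono k y fun u hu z => by
              rw [mul_one]
              exact hEM u ⟨hu.1.le, hu.2.trans hs.2⟩ z
          _ = M * r.jumpIntegral k (fun _ _ => 1) s y := r.jumpIntegral_const_mul k hMtop _ s y
          _ ≤ _ := by
            refine mul_le_mul_right ((r.jumpIntegral_one_le y (hk y) hs.1).trans
              (ENNReal.ofReal_le_ofReal ?_)) M
            have h0 : 0 ≤ k y := (r.rate_pos y).le.trans (hk y)
            have : k y * s ≤ |κ| * T :=
              mul_le_mul ((hκ y hy).trans (le_abs_self κ)) hs.2 hs.1 (abs_nonneg κ)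
            gcongr
      · rw [hEN s hs y hy]
        exact zero_le
    have hM0 : M = 0 := by
      by_contra hne
      refine absurd hMle (not_le.2 ?_)
      calc M * ENNReal.ofReal (1 - Real.exp (-(|κ| * T))) < M * 1 := by
            refine (ENNReal.mul_lt_mul_iff_right hne hMtop).2 ?_
            rw [ENNReal.ofReal_lt_one]
            linarith [Real.exp_pos (-(|κ| * T))]
        _ = M := mul_one M
    have h := hEM t ht x
    rw [hM0, nonpos_iff_eq_zero, hE, tsub_eq_zero_iff_le] at h
    refine h.trans (le_of_eq ?_)
    simp only [hΨ]
    congr 1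
    ring
  set A := Real.exp (3 * Λ * t) * (1 + (x : ℝ)) ^ 2 with hA
  have hA0 : 0 < A := by positivity
  refine le_antisymm (ENNReal.le_of_forall_pos_le_add fun ε hε _ => ?_) zero_le
  have := key (ε / A) (div_pos hε hA0)
  rw [div_mul_cancel₀ _ hA0.ne'] at this
  simpa using this

end BirthDeathRates

/-! ### Integrability and the backward equation for `P_t f`. -/

namespace BirthDeathRates
variable (r : BirthDeathRates)

lemma measurable_process (x : ℕ) (t : ℝ) : Measurable (r.process x t) := by
  have hidx : Measurable fun ω => sInf {n | t < r.jumpTime x ω (n + 1)} := by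
    refine measurable_to_countable' fun m => ?_
    have hS : ∀ n, MeasurableSet {ω | t < r.jumpTime x ω (n + 1)} := fun n =>
      measurableSet_lt measurable_const (r.measurable_jumpTime x (n + 1))
    -- The second set of the union accounts for `sInf ∅ = 0`.
    have h : (fun ω => sInf {n | t < r.jumpTime x ω (n + 1)}) ⁻¹' {m} =
        ({ω | t < r.jumpTime x ω (m + 1)} ∩ ⋂ j < m, {ω | t < r.jumpTime x ω (j + 1)}ᶜ) ∪
          ({_ω | m = 0} ∩ ⋂ j, {ω | t < r.jumpTime x ω (j + 1)}ᶜ) := by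
      ext ω
      simp only [Set.mem_preimage, Set.mem_singleton_iff, Set.mem_union, Set.mem_inter_iff,
        Set.mem_iInter, Set.mem_compl_iff, Set.mem_ofPred_eq]
      constructor
      · rintro rfl
        by_cases hne : {n | t < r.jumpTime x ω (n + 1)}.Nonempty
        · exact Or.inl ⟨Nat.sInf_mem hne, fun j hj => Nat.notMem_of_lt_sInf hj⟩
        · rw [Set.not_nonempty_iff_eq_empty] at hne
          refine Or.inr ⟨by rw [hne, Nat.sInf_empty], fun j hj => ?_⟩
          exact (hne ▸ hj : j ∈ (∅ : Set ℕ))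
      · rintro (⟨h1, h2⟩ | ⟨rfl, h2⟩)
        · refine le_antisymm (Nat.sInf_le h1) ?_
          by_contra hlt
          exact h2 _ (not_le.1 hlt) (Nat.sInf_mem (s := {n | t < r.jumpTime x ω (n + 1)}) ⟨m, h1⟩)
        · rw [Nat.sInf_eq_zero]
          exact Or.inr (Set.eq_empty_iff_forall_notMem.2 h2)
    rw [h]
    exact ((hS m).inter (MeasurableSet.iInter fun j => MeasurableSet.iInter fun _ =>
      (hS j).compl)).union ((MeasurableSet.const _).inter
        (MeasurableSet.iInter fun j => (hS j).compl))
  have h1 : Measurable fun q : ℕ × Noise => r.chain x q.2 q.1 :=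
    measurable_from_prod_countable_right fun n => r.measurable_chain x n
  exact h1.comp (hidx.prodMk measurable_id)

lemma feynmanKac_zero_potential (t : ℝ) (g : ℕ → ℝ≥0∞) (x : ℕ) :
    r.feynmanKac (fun _ => 0) t g x = ∫⁻ ω in r.alive x t, g (r.process x t ω) ∂noise := by
  simp [feynmanKac]

variable {r}

lemma integrableOn_process {Λ : ℝ} (hΛ : ∀ x, r.birth x ≤ Λ) {f : ℕ → ℝ} {C : ℝ}
    (hf : ∀ x : ℕ, |f x| ≤ C * (1 + x)) {t : ℝ} (ht : 0 ≤ t) (x : ℕ) :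
    IntegrableOn (fun ω => f (r.process x t ω)) (r.alive x t) noise := by
  have hC : 0 ≤ C := by simpa using (abs_nonneg _).trans (hf 0)
  refine ⟨((measurable_from_nat (f := f)).comp
    (r.measurable_process x t)).aestronglyMeasurable, ?_⟩
  rw [hasFiniteIntegral_iff_norm]
  refine lt_of_le_of_lt ?_ (ENNReal.ofReal_lt_top
    (r := Real.exp (Λ * t) * (C * (1 + x))))
  have h := r.feynmanKac_le_linear hΛ (V := fun _ => 0) (fun _ => le_rfl)
    (g := fun y => ENNReal.ofReal ‖f y‖) hC (fun y => ENNReal.ofReal_le_ofReal (hf y)) ht x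
  rwa [feynmanKac_zero_potential] at h

lemma abs_semigroup_le {Λ : ℝ} (hΛ : ∀ x, r.birth x ≤ Λ) {f : ℕ → ℝ} {C : ℝ}
    (hf : ∀ x : ℕ, |f x| ≤ C * (1 + x)) {t : ℝ} (ht : 0 ≤ t) (x : ℕ) :
    |r.semigroup t f x| ≤ Real.exp (Λ * t) * (C * (1 + x)) := by
  have hC : 0 ≤ C := by simpa using (abs_nonneg _).trans (hf 0)
  have h := r.feynmanKac_le_linear hΛ (V := fun _ => 0) (fun _ => le_rfl)
    (g := fun y => ENNReal.ofReal ‖f y‖) hC (fun y => ENNReal.ofReal_le_ofReal (hf y)) ht x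
  rw [feynmanKac_zero_potential] at h
  exact (norm_integral_le_lintegral_norm _).trans (ENNReal.toReal_le_of_le_ofReal (by positivity) h)

lemma semigroup_eq_sub {Λ : ℝ} (hΛ : ∀ x, r.birth x ≤ Λ) {f : ℕ → ℝ} {C : ℝ}
    (hf : ∀ x : ℕ, |f x| ≤ C * (1 + x)) {t : ℝ} (ht : 0 ≤ t) (x : ℕ) :
    r.semigroup t f x =
      (r.feynmanKac (fun _ => 0) t (fun y => ENNReal.ofReal (f y)) x).toReal -
      (r.feynmanKac (fun _ => 0) t (fun y => ENNReal.ofReal (-f y)) x).toReal := by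
  rw [semigroup, integral_eq_lintegral_pos_part_sub_lintegral_neg_part
    (integrableOn_process hΛ hf ht x), feynmanKac_zero_potential, feynmanKac_zero_potential]

/-- The right-hand side of the backward equation without the diagonal term. -/
def jumpSum (r : BirthDeathRates) (u : ℕ → ℝ) (x : ℕ) : ℝ :=
  r.birth x * u (x + 1) + r.death x * u (x - 1)

/-- Multiplying by `exp (rate * t)` removes `t` from the integrand, which leaves a primitive that
can be differentiated. -/
lemma toReal_feynmanKac_eq {Λ : ℝ} (hΛ : ∀ x, r.birth x ≤ Λ) {g : ℕ → ℝ≥0∞} {C : ℝ} (hC : 0 ≤ C)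
    (hg : ∀ x : ℕ, g x ≤ ENNReal.ofReal (C * (1 + x))) {t : ℝ} (ht : 0 ≤ t) (x : ℕ) :
    IntervalIntegrable (fun u => Real.exp (r.rate x * u) *
      r.jumpSum (fun y => (r.feynmanKac (fun _ => 0) u g y).toReal) x) volume 0 t ∧
    Real.exp (r.rate x * t) * (r.feynmanKac (fun _ => 0) t g x).toReal =
      (g x).toReal + ∫ u in (0 : ℝ)..t, Real.exp (r.rate x * u) *
        r.jumpSum (fun y => (r.feynmanKac (fun _ => 0) u g y).toReal) x := by
  have hb := (r.birth_pos x).le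
  have hd := r.death_nonneg x
  have hle : ∀ u, 0 ≤ u → ∀ y, r.feynmanKac (fun _ => 0) u g y ≤
      ENNReal.ofReal (Real.exp (Λ * u) * (C * (1 + y))) := fun u hu y =>
    r.feynmanKac_le_linear hΛ (fun _ => le_rfl) hC hg hu y
  have hfin : ∀ u, 0 ≤ u → ∀ y, r.feynmanKac (fun _ => 0) u g y ≠ ∞ := fun u hu y =>
    ne_top_of_le_ne_top ENNReal.ofReal_ne_top (hle u hu y)
  choose F hFm hF using r.exists_measurable_feynmanKac (fun _ => 0) g
  have heq := r.feynmanKac_eq (fun _ => 0) g ht x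
  simp only [jumpIntegral, add_zero] at heq
  set h : ℝ → ℝ≥0∞ := fun u => ENNReal.ofReal (Real.exp (-(r.rate x * (t - u)))) *
    (ENNReal.ofReal (r.birth x) * r.feynmanKac (fun _ => 0) u g (x + 1) +
      ENNReal.ofReal (r.death x) * r.feynmanKac (fun _ => 0) u g (x - 1)) with hh
  have hhm : AEMeasurable h (volume.restrict (Set.Ioc 0 t)) := by
    have h1 := hFm (x + 1)
    have h2 := hFm (x - 1)
    refine AEMeasurable.congr (f := fun u => ENNReal.ofReal (Real.exp (-(r.rate x * (t - u)))) *
      (ENNReal.ofReal (r.birth x) * F (x + 1) u + ENNReal.ofReal (r.death x) * F (x - 1) u))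
      (by fun_prop) ?_
    filter_upwards [ae_restrict_mem measurableSet_Ioc] with u hu
    simp only [hh]
    rw [hF _ _ hu.1.le, hF _ _ hu.1.le]
  have hlint : ∫⁻ u in Set.Ioc 0 t, h u ≠ ∞ := by
    refine ne_top_of_le_ne_top (hfin t ht x) ?_
    rw [heq]
    exact le_add_self
  have htop : ∀ᵐ u ∂(volume.restrict (Set.Ioc 0 t)), h u < ∞ := ae_lt_top' hhm hlint
  have hI : IntegrableOn (fun u => (h u).toReal) (Set.Ioc 0 t) :=
    integrable_toReal_of_lintegral_ne_top hhm hlint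
  have hreal : ∀ u ∈ Set.Ioc 0 t, Real.exp (r.rate x * u) *
      r.jumpSum (fun y => (r.feynmanKac (fun _ => 0) u g y).toReal) x =
        Real.exp (r.rate x * t) * (h u).toReal := by
    intro u hu
    simp only [hh, jumpSum]
    rw [ENNReal.toReal_mul, ENNReal.toReal_add (ENNReal.mul_ne_top ENNReal.ofReal_ne_top
        (hfin u hu.1.le _)) (ENNReal.mul_ne_top ENNReal.ofReal_ne_top (hfin u hu.1.le _)),
      ENNReal.toReal_mul, ENNReal.toReal_mul, ENNReal.toReal_ofReal hb,
      ENNReal.toReal_ofReal hd, ENNReal.toReal_ofReal (Real.exp_pos _).le, ← mul_assoc,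
      ← Real.exp_add]
    congr 2
    ring
  refine ⟨?_, ?_⟩
  · rw [intervalIntegrable_iff_integrableOn_Ioc_of_le ht]
    exact IntegrableOn.congr_fun (hI.const_mul (Real.exp (r.rate x * t)))
      (fun u hu => (hreal u hu).symm) measurableSet_Ioc
  · rw [intervalIntegral.integral_of_le ht, setIntegral_congr_fun measurableSet_Ioc hreal,
      integral_const_mul, integral_toReal hhm htop, heq,
      ENNReal.toReal_add (ENNReal.mul_ne_top ENNReal.ofReal_ne_top
        (ne_top_of_le_ne_top ENNReal.ofReal_ne_top (hg x))) hlint, ENNReal.toReal_mul,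
      ENNReal.toReal_ofReal (Real.exp_pos _).le, mul_add, ← mul_assoc, ← Real.exp_add]
    simp

/-- Integrated backward equation. -/
lemma semigroup_eq_integral {Λ : ℝ} (hΛ : ∀ x, r.birth x ≤ Λ) {f : ℕ → ℝ} {C : ℝ}
    (hf : ∀ x : ℕ, |f x| ≤ C * (1 + x)) {t : ℝ} (ht : 0 ≤ t) (x : ℕ) :
    IntervalIntegrable (fun u => Real.exp (r.rate x * u) * r.jumpSum (r.semigroup u f) x)
      volume 0 t ∧
    Real.exp (r.rate x * t) * r.semigroup t f x =
      f x + ∫ u in (0 : ℝ)..t, Real.exp (r.rate x * u) * r.jumpSum (r.semigroup u f) x := by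
  have hC : 0 ≤ C := by simpa using (abs_nonneg _).trans (hf 0)
  obtain ⟨i1, e1⟩ := toReal_feynmanKac_eq (r := r) hΛ (g := fun y => ENNReal.ofReal (f y)) hC
    (fun y => ENNReal.ofReal_le_ofReal ((le_abs_self _).trans (hf y))) ht x
  obtain ⟨i2, e2⟩ := toReal_feynmanKac_eq (r := r) hΛ (g := fun y => ENNReal.ofReal (-f y)) hC
    (fun y => ENNReal.ofReal_le_ofReal ((neg_le_abs _).trans (hf y))) ht x
  have hsub : ∀ u, 0 ≤ u → Real.exp (r.rate x * u) * r.jumpSum (r.semigroup u f) x =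
      Real.exp (r.rate x * u) * r.jumpSum (fun y => (r.feynmanKac (fun _ => 0) u
        (fun y => ENNReal.ofReal (f y)) y).toReal) x -
      Real.exp (r.rate x * u) * r.jumpSum (fun y => (r.feynmanKac (fun _ => 0) u
        (fun y => ENNReal.ofReal (-f y)) y).toReal) x := by
    intro u hu
    simp only [jumpSum]
    rw [semigroup_eq_sub hΛ hf hu, semigroup_eq_sub hΛ hf hu]
    ring
  have hEq : Set.EqOn (fun u => Real.exp (r.rate x * u) * r.jumpSum (r.semigroup u f) x)
      (fun u => Real.exp (r.rate x * u) * r.jumpSum (fun y => (r.feynmanKac (fun _ => 0) u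
        (fun y => ENNReal.ofReal (f y)) y).toReal) x -
      Real.exp (r.rate x * u) * r.jumpSum (fun y => (r.feynmanKac (fun _ => 0) u
        (fun y => ENNReal.ofReal (-f y)) y).toReal) x) (Set.uIcc 0 t) := by
    intro u hu
    rw [Set.uIcc_of_le ht] at hu
    exact hsub u hu.1
  refine ⟨(i1.sub i2).congr fun u hu => (hEq (Set.uIoc_subset_uIcc hu)).symm, ?_⟩
  rw [intervalIntegral.integral_congr hEq, intervalIntegral.integral_sub i1 i2,
    semigroup_eq_sub hΛ hf ht, mul_sub, e1, e2, ENNReal.toReal_ofReal', ENNReal.toReal_ofReal']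
  have := max_zero_sub_max_neg_zero_eq_self (f x)
  linarith

lemma semigroup_zero {Λ : ℝ} (hΛ : ∀ x, r.birth x ≤ Λ) {f : ℕ → ℝ} {C : ℝ}
    (hf : ∀ x : ℕ, |f x| ≤ C * (1 + x)) (x : ℕ) : r.semigroup 0 f x = f x := by
  simpa using (semigroup_eq_integral hΛ hf le_rfl x).2

/-- Bootstrap: a primitive of an integrable function is continuous; this makes the integrand itself
continuous, hence the primitive differentiable in the next lemma. -/
lemma continuousOn_semigroup {Λ : ℝ} (hΛ : ∀ x, r.birth x ≤ Λ) {f : ℕ → ℝ} {C : ℝ}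
    (hf : ∀ x : ℕ, |f x| ≤ C * (1 + x)) (T : ℝ) (x : ℕ) :
    ContinuousOn (fun t => r.semigroup t f x) (Set.Icc 0 T) := by
  rcases lt_or_ge T 0 with hT | hT
  · simp [Set.Icc_eq_empty hT.not_ge]
  have h1 : ContinuousOn (fun t => Real.exp (-(r.rate x * t)) * (f x + ∫ u in (0 : ℝ)..t,
      Real.exp (r.rate x * u) * r.jumpSum (r.semigroup u f) x)) (Set.Icc 0 T) := by
    refine ContinuousOn.mul (by fun_prop) (continuousOn_const.add ?_)
    have hi := (semigroup_eq_integral (r := r) hΛ hf hT x).1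
    have := intervalIntegral.continuousOn_primitive_interval (a := 0) (b := T) (μ := volume)
      (f := fun u => Real.exp (r.rate x * u) * r.jumpSum (r.semigroup u f) x)
      (by rw [Set.uIcc_of_le hT, integrableOn_Icc_iff_integrableOn_Ioc]
          exact (intervalIntegrable_iff_integrableOn_Ioc_of_le hT).1 hi)
    rwa [Set.uIcc_of_le hT] at this
  refine h1.congr fun t ht => ?_
  simp only
  rw [← (semigroup_eq_integral hΛ hf ht.1 x).2, ← mul_assoc, ← Real.exp_add]
  simp

/-- Backward Kolmogorov equation. -/
lemma hasDerivAt_semigroup {Λ : ℝ} (hΛ : ∀ x, r.birth x ≤ Λ) {f : ℕ → ℝ} {C : ℝ}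
    (hf : ∀ x : ℕ, |f x| ≤ C * (1 + x)) {t : ℝ} (ht : 0 < t) (x : ℕ) :
    HasDerivAt (fun t => r.semigroup t f x)
      (r.jumpSum (r.semigroup t f) x - r.rate x * r.semigroup t f x) t := by
  set G : ℝ → ℝ := fun u => Real.exp (r.rate x * u) * r.jumpSum (r.semigroup u f) x with hG
  have hcont : ContinuousOn G (Set.Icc 0 (t + 1)) := by
    have h1 := continuousOn_semigroup (r := r) hΛ hf (t + 1) (x + 1)
    have h2 := continuousOn_semigroup (r := r) hΛ hf (t + 1) (x - 1)
    simp only [hG, jumpSum]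
    fun_prop
  have hnhds : Set.Icc 0 (t + 1) ∈ nhds t := Icc_mem_nhds ht (by linarith)
  have hmeas : StronglyMeasurableAtFilter G (nhds t) volume :=
    ContinuousOn.stronglyMeasurableAtFilter isOpen_Ioo (hcont.mono Set.Ioo_subset_Icc_self) t
      ⟨ht, by linarith⟩
  have hI := intervalIntegral.integral_hasDerivAt_right
    (semigroup_eq_integral (r := r) hΛ hf ht.le x).1 hmeas (hcont.continuousAt hnhds)
  have hexp : HasDerivAt (fun s => Real.exp (-(r.rate x * s)))
      (-r.rate x * Real.exp (-(r.rate x * t))) t := by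
    refine (((hasDerivAt_id t).const_mul (r.rate x)).neg.exp).congr_deriv ?_
    simp only [id, Pi.neg_apply]
    ring
  have hmul := hexp.mul (hI.const_add (f x))
  have heq : (fun s => r.semigroup s f x) =ᶠ[nhds t] fun s => Real.exp (-(r.rate x * s)) *
      (f x + ∫ u in (0 : ℝ)..s, G u) := by
    filter_upwards [Ioi_mem_nhds ht] with s hs
    rw [← (semigroup_eq_integral hΛ hf (le_of_lt hs) x).2, ← mul_assoc, ← Real.exp_add]
    simp
  refine (HasDerivAt.congr_of_eventuallyEq hmul heq).congr_deriv ?_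
  have e1 : Real.exp (-(r.rate x * t)) * Real.exp (r.rate x * t) = 1 := by
    rw [← Real.exp_add]; simp
  rw [← (semigroup_eq_integral hΛ hf ht.le x).2]
  linear_combination (r.jumpSum (r.semigroup t f) x - r.rate x * r.semigroup t f x) * e1

end BirthDeathRates

/-! ### Joint convexity of `B^φ` and its tangent planes. -/

section Convexity

variable {I : Set ℝ} {φ : ℝ → ℝ}

lemma hasDerivAt_deriv_of_contDiffOn (hIo : IsOpen I) (hφ : ContDiffOn ℝ (⊤ : ℕ∞) φ I) {a : ℝ}
    (ha : a ∈ I) : HasDerivAt (deriv φ) (deriv (deriv φ) a) a :=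
  (((hφ.deriv_of_isOpen (m := 1) hIo (by norm_cast)).differentiableOn one_ne_zero).differentiableAt
    (hIo.mem_nhds ha)).hasDerivAt

lemma continuousOn_deriv_deriv (hIo : IsOpen I) (hφ : ContDiffOn ℝ (⊤ : ℕ∞) φ I) :
    ContinuousOn (deriv (deriv φ)) I :=
  ((hφ.deriv_of_isOpen (m := 1) hIo (by norm_cast)).deriv_of_isOpen (m := 0) hIo
    (by norm_num)).continuousOn

lemma add_mul_sub_mem (hIc : I.OrdConnected) {a b u : ℝ} (ha : a ∈ I) (hb : b ∈ I)
    (hu : u ∈ Set.Icc (0 : ℝ) 1) : a + u * (b - a) ∈ I :=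
  hIc.convex.add_smul_sub_mem ha hb hu

/-- `B^φ` is an average of the values of `(r, s) ↦ φ''(r) s ^ 2` on a segment. -/
lemma bTransform_eq_integral (hIo : IsOpen I) (hIc : I.OrdConnected)
    (hφ : ContDiffOn ℝ (⊤ : ℕ∞) φ I) {a b : ℝ} (ha : a ∈ I) (hb : b ∈ I) :
    IntervalIntegrable (fun u => deriv (deriv φ) (a + u * (b - a)) * (b - a) ^ 2) volume 0 1 ∧
    bTransform φ a (b - a) =
      ∫ u in (0 : ℝ)..1, deriv (deriv φ) (a + u * (b - a)) * (b - a) ^ 2 := by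
  have hmem : ∀ u ∈ Set.uIcc (0 : ℝ) 1, a + u * (b - a) ∈ I := fun u hu =>
    add_mul_sub_mem hIc ha hb (by rwa [Set.uIcc_of_le zero_le_one] at hu)
  have hc : ContinuousOn (fun u => deriv (deriv φ) (a + u * (b - a)) * (b - a) ^ 2)
      (Set.uIcc 0 1) :=
    ((continuousOn_deriv_deriv hIo hφ).comp (by fun_prop) hmem).mul continuousOn_const
  refine ⟨hc.intervalIntegrable, ?_⟩
  have hd : ∀ u ∈ Set.uIcc (0 : ℝ) 1, HasDerivAt (fun u => deriv φ (a + u * (b - a)) * (b - a))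
      (deriv (deriv φ) (a + u * (b - a)) * (b - a) ^ 2) u := by
    intro u hu
    have h1 : HasDerivAt (fun u : ℝ => a + u * (b - a)) (b - a) u := by
      simpa using ((hasDerivAt_id u).mul_const (b - a)).const_add a
    refine (((hasDerivAt_deriv_of_contDiffOn hIo hφ (hmem u hu)).comp u h1).mul_const
      (b - a)).congr_deriv ?_
    ring
  rw [intervalIntegral.integral_eq_sub_of_hasDerivAt hd hc.intervalIntegrable]
  simp only [bTransform, one_mul, zero_mul, add_zero]
  ring

/-- For `v > 0`, `v * c ^ 2` is the supremum over `m` of `2 * m * c - m ^ 2 / v`. With `v = φ''(p)`,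
each such expression is jointly convex in `(p, c)` because `-1/φ''` is convex, and a supremum of
convex functions is convex. -/
lemma mul_sq_convex_of_neg_inv_convex (hφ2 : ∀ a ∈ I, 0 < deriv (deriv φ) a)
    (hφi : ConvexOn ℝ I fun a => -1 / deriv (deriv φ) a) {p p' s s' θ θ' : ℝ} (hp : p ∈ I)
    (hp' : p' ∈ I) (hθ : 0 ≤ θ) (hθ' : 0 ≤ θ') (hsum : θ + θ' = 1) :
    deriv (deriv φ) (θ * p + θ' * p') * (θ * s + θ' * s') ^ 2 ≤
      θ * (deriv (deriv φ) p * s ^ 2) + θ' * (deriv (deriv φ) p' * s' ^ 2) := by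
  have hmid : θ * p + θ' * p' ∈ I := hφi.1 hp hp' hθ hθ' hsum
  have hconv := hφi.2 hp hp' hθ hθ' hsum
  simp only [smul_eq_mul, neg_div, one_div] at hconv
  set w := deriv (deriv φ) (θ * p + θ' * p')
  have hw : 0 < w := hφ2 _ hmid
  have aux : ∀ m v c : ℝ, 0 < v → 2 * m * c - m ^ 2 * v⁻¹ ≤ v * c ^ 2 := by
    intro m v c hv
    have h : v * c ^ 2 - (2 * m * c - m ^ 2 * v⁻¹) = v * (c - m * v⁻¹) ^ 2 := by
      field_simp
      ring
    have : 0 ≤ v * (c - m * v⁻¹) ^ 2 := by positivity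
    linarith
  -- The `m` that attains the supremum at the intermediate point.
  set m := w * (θ * s + θ' * s') with hm
  have e : w * (θ * s + θ' * s') ^ 2 = 2 * m * (θ * s + θ' * s') - m ^ 2 * w⁻¹ := by
    rw [hm]
    field_simp
    ring
  have h1 := mul_le_mul_of_nonneg_left (aux m _ s (hφ2 p hp)) hθ
  have h2 := mul_le_mul_of_nonneg_left (aux m _ s' (hφ2 p' hp')) hθ'
  have h3 := mul_le_mul_of_nonneg_left hconv (sq_nonneg m)
  rw [e]
  linarith

/-- Joint convexity of `(a, b) ↦ B^φ(a, b - a)`. -/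
lemma bTransform_convex (hIo : IsOpen I) (hIc : I.OrdConnected)
    (hφ : ContDiffOn ℝ (⊤ : ℕ∞) φ I) (hφ2 : ∀ a ∈ I, 0 < deriv (deriv φ) a)
    (hφi : ConvexOn ℝ I fun a => -1 / deriv (deriv φ) a) {a b a' b' θ θ' : ℝ} (ha : a ∈ I)
    (hb : b ∈ I) (ha' : a' ∈ I) (hb' : b' ∈ I) (hθ : 0 ≤ θ) (hθ' : 0 ≤ θ') (hsum : θ + θ' = 1) :
    bTransform φ (θ * a + θ' * a') ((θ * b + θ' * b') - (θ * a + θ' * a')) ≤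
      θ * bTransform φ a (b - a) + θ' * bTransform φ a' (b' - a') := by
  have hA : θ * a + θ' * a' ∈ I := hIc.convex ha ha' hθ hθ' hsum
  have hB : θ * b + θ' * b' ∈ I := hIc.convex hb hb' hθ hθ' hsum
  obtain ⟨i1, e1⟩ := bTransform_eq_integral hIo hIc hφ ha hb
  obtain ⟨i2, e2⟩ := bTransform_eq_integral hIo hIc hφ ha' hb'
  obtain ⟨i3, e3⟩ := bTransform_eq_integral hIo hIc hφ hA hB
  rw [e1, e2, e3, ← intervalIntegral.integral_const_mul, ← intervalIntegral.integral_const_mul,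
    ← intervalIntegral.integral_add (i1.const_mul θ) (i2.const_mul θ')]
  refine intervalIntegral.integral_mono_on zero_le_one i3
    ((i1.const_mul θ).add (i2.const_mul θ')) fun u hu => ?_
  have h := mul_sq_convex_of_neg_inv_convex hφ2 hφi (s := b - a) (s' := b' - a')
    (add_mul_sub_mem hIc ha hb hu) (add_mul_sub_mem hIc ha' hb' hu) hθ hθ' hsum
  refine le_trans (le_of_eq ?_) h
  congr 2
  · ring
  · ring

/-- `B^φ` lies above its tangent planes. -/
lemma exists_affine_le_bTransform (hIo : IsOpen I) (hIc : I.OrdConnected)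
    (hφ : ContDiffOn ℝ (⊤ : ℕ∞) φ I) (hφ2 : ∀ a ∈ I, 0 < deriv (deriv φ) a)
    (hφi : ConvexOn ℝ I fun a => -1 / deriv (deriv φ) a) {a₀ b₀ : ℝ} (ha₀ : a₀ ∈ I)
    (hb₀ : b₀ ∈ I) :
    ∃ c α β : ℝ, bTransform φ a₀ (b₀ - a₀) = c + α * a₀ + β * b₀ ∧
      ∀ a ∈ I, ∀ b ∈ I, c + α * a + β * b ≤ bTransform φ a (b - a) := by
  -- `α` and `β` are the partial derivatives of `(φ'(b) - φ'(a)) * (b - a)` at `(a₀, b₀)`.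
  set α : ℝ := -(deriv (deriv φ) a₀ * (b₀ - a₀)) - (deriv φ b₀ - deriv φ a₀) with hα
  set β : ℝ := deriv (deriv φ) b₀ * (b₀ - a₀) + (deriv φ b₀ - deriv φ a₀) with hβ
  refine ⟨bTransform φ a₀ (b₀ - a₀) - α * a₀ - β * b₀, α, β, by ring, fun a ha b hb => ?_⟩
  set h : ℝ → ℝ := fun s => (deriv φ (b₀ + s * (b - b₀)) - deriv φ (a₀ + s * (a - a₀))) *
    ((b₀ + s * (b - b₀)) - (a₀ + s * (a - a₀))) with hh
  have hB : ∀ s, h s = bTransform φ (a₀ + s * (a - a₀))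
      ((b₀ + s * (b - b₀)) - (a₀ + s * (a - a₀))) := fun s => by
    simp only [hh, bTransform, add_sub_cancel]
  have hline : ∀ c d : ℝ, HasDerivAt (fun s : ℝ => c + s * (d - c)) (d - c) 0 := fun c d => by
    simpa using ((hasDerivAt_id (0 : ℝ)).mul_const (d - c)).const_add c
  have hdl : ∀ {c : ℝ} (d : ℝ), c ∈ I → HasDerivAt (fun s : ℝ => deriv φ (c + s * (d - c)))
      (deriv (deriv φ) c * (d - c)) 0 := fun {c} d hc =>
    HasDerivAt.comp (h₂ := deriv φ) 0
      (by simpa using hasDerivAt_deriv_of_contDiffOn hIo hφ hc) (hline c d)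
  have hder : HasDerivAt h (α * (a - a₀) + β * (b - b₀)) 0 := by
    refine (((hdl b hb₀).sub (hdl a ha₀)).mul ((hline b₀ b).sub (hline a₀ a))).congr_deriv ?_
    simp only [zero_mul, add_zero, hα, hβ, Pi.sub_apply]
    ring
  -- Along the segment from `(a₀, b₀)` to `(a, b)`, convexity bounds every difference quotient by
  -- the total increment; let `s → 0⁺`.
  have hle : α * (a - a₀) + β * (b - b₀) ≤ bTransform φ a (b - a) - bTransform φ a₀ (b₀ - a₀) := by
    refine le_of_tendsto hder.tendsto_slope_zero_right ?_
    filter_upwards [Ioc_mem_nhdsGT (zero_lt_one' ℝ)] with s hs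
    have hc := bTransform_convex hIo hIc hφ hφ2 hφi ha₀ hb₀ ha hb (sub_nonneg.2 hs.2) hs.1.le
      (sub_add_cancel 1 s)
    have h0 : h 0 = bTransform φ a₀ (b₀ - a₀) := by simp [hB]
    have hs' : h s ≤ (1 - s) * bTransform φ a₀ (b₀ - a₀) + s * bTransform φ a (b - a) := by
      rw [hB]
      refine le_trans (le_of_eq ?_) hc
      congr 1 <;> ring
    rw [zero_add, h0, smul_eq_mul, inv_mul_le_iff₀ hs.1]
    linarith
  linarith

end Convexity

/-! ### From affine minorants to the Feynman-Kac bound. -/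

lemma abs_le_linear_of_bddAbove_fwdGrad {f : ℕ → ℝ}
    (hf : BddAbove (Set.range fun y => |fwdGrad f y|)) :
    ∃ C, ∀ x : ℕ, |f x| ≤ C * (1 + x) := by
  obtain ⟨M, hM⟩ := hf
  have hM' : ∀ y, |f (y + 1) - f y| ≤ M := fun y => hM ⟨y, rfl⟩
  have hM0 : 0 ≤ M := (abs_nonneg _).trans (hM' 0)
  have h : ∀ x : ℕ, |f x| ≤ |f 0| + M * x := by
    intro x
    induction x with
    | zero => simp
    | succ x ih =>
      have := abs_add_le (f (x + 1) - f x) (f x)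
      rw [sub_add_cancel] at this
      push_cast
      linarith [hM' x]
  refine ⟨|f 0| + M, fun x => (h x).trans ?_⟩
  have : 0 ≤ |f 0| * x := by positivity
  linarith

namespace BirthDeathRates
variable {r : BirthDeathRates}

lemma NonExplosive.restrict_alive (hne : r.NonExplosive) (x : ℕ) (t : ℝ) :
    noise.restrict (r.alive x t) = noise :=
  Measure.restrict_eq_self_of_ae_mem ((hne x).mono fun _ h => h t)

/-- Non-explosion is essential here: it makes `P_t` preserve the constant `c`. -/
lemma semigroup_affine_nonpos (hne : r.NonExplosive) {f : ℕ → ℝ} {t : ℝ} {x : ℕ}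
    (hint : IntegrableOn (fun ω => f (r.process x t ω)) (r.alive x t) noise) {c γ : ℝ}
    (h : ∀ y, c + γ * f y ≤ 0) : c + γ * r.semigroup t f x ≤ 0 := by
  rw [IntegrableOn, hne.restrict_alive] at hint
  have e : c + γ * r.semigroup t f x = ∫ ω, (c + γ * f (r.process x t ω)) ∂noise := by
    rw [integral_add (integrable_const c) (hint.const_mul γ), integral_const_mul, semigroup,
      hne.restrict_alive]
    simp
  rw [e]
  exact integral_nonpos fun ω => h _

/-- An integrable variable takes a value at most its mean and a value at least its mean;
order-connectedness does the rest. -/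
lemma semigroup_mem (hne : r.NonExplosive) {I : Set ℝ} (hIc : I.OrdConnected)
    {f : ℕ → ℝ} (hfI : ∀ x, f x ∈ I) {t : ℝ} {x : ℕ}
    (hint : IntegrableOn (fun ω => f (r.process x t ω)) (r.alive x t) noise) :
    r.semigroup t f x ∈ I := by
  rw [IntegrableOn, hne.restrict_alive] at hint
  have e : r.semigroup t f x = ∫ ω, f (r.process x t ω) ∂noise := by
    rw [semigroup, hne.restrict_alive]
  have h1 : ∃ ω, f (r.process x t ω) ≤ r.semigroup t f x := by
    rw [e]
    exact exists_le_integral hint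
  have h2 : ∃ ω, r.semigroup t f x ≤ f (r.process x t ω) := by
    rw [e]
    exact exists_integral_le hint
  obtain ⟨ω₁, h1⟩ := h1
  obtain ⟨ω₂, h2⟩ := h2
  exact hIc.out (hfI _) (hfI _) ⟨h1, h2⟩

variable (r)

@[simp] lemma oneModification_birth (x : ℕ) : r.oneModification.birth x = r.birth (x + 1) := by
  simp [oneModification, modification]

@[simp] lemma oneModification_death (x : ℕ) : r.oneModification.death x = r.death x := by
  simp [oneModification, modification]

lemma onePotential_eq (x : ℕ) :
    r.onePotential x = r.death (x + 1) - r.death x + r.birth x - r.birth (x + 1) := by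
  simp [onePotential, potential, modification]

lemma oneModification_rate_add_onePotential (x : ℕ) :
    r.oneModification.rate x + r.onePotential x = r.birth x + r.death (x + 1) := by
  rw [rate, onePotential_eq, oneModification_birth, oneModification_death]
  ring

variable {r}

/-- An affine combination `W` of two neighbouring values of `P_t f` is a subsolution of the
first-jump decomposition of the Feynman-Kac semigroup of the `1`-modification, provided the same
combination of two equal values is nonpositive. -/
lemma ofReal_affine_semigroup_le {Λ : ℝ} (hΛ : ∀ x, r.birth x ≤ Λ) (hbirth : Antitone r.birth)
    (hdeath : Monotone r.death) {f : ℕ → ℝ} {C : ℝ} (hf : ∀ x : ℕ, |f x| ≤ C * (1 + x))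
    {c α β : ℝ} (hK : ∀ u, 0 ≤ u → ∀ y, c + (α + β) * r.semigroup u f y ≤ 0)
    {t : ℝ} (ht : 0 ≤ t) (x : ℕ) :
    ENNReal.ofReal (c + α * r.semigroup t f x + β * r.semigroup t f (x + 1)) ≤
      ENNReal.ofReal (Real.exp (-((r.oneModification.rate x + r.onePotential x) * t))) *
          ENNReal.ofReal (c + α * f x + β * f (x + 1)) +
        r.oneModification.jumpIntegral (fun y => r.oneModification.rate y + r.onePotential y)
          (fun u y => ENNReal.ofReal
            (c + α * r.semigroup u f y + β * r.semigroup u f (y + 1))) t x := by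
  simp only [jumpIntegral, oneModification_rate_add_onePotential, oneModification_birth,
    oneModification_death]
  set k := r.birth x + r.death (x + 1) with hk
  set W : ℝ → ℕ → ℝ := fun u y => c + α * r.semigroup u f y + β * r.semigroup u f (y + 1) with hW
  have hWc : ∀ y, ContinuousOn (fun u => W u y) (Set.Icc 0 t) := fun y => by
    have h1 := continuousOn_semigroup (r := r) hΛ hf t y
    have h2 := continuousOn_semigroup (r := r) hΛ hf t (y + 1)
    simp only [hW]
    fun_prop
  set W' : ℝ → ℝ := fun u =>
    α * (r.jumpSum (r.semigroup u f) x - r.rate x * r.semigroup u f x) +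
    β * (r.jumpSum (r.semigroup u f) (x + 1) - r.rate (x + 1) * r.semigroup u f (x + 1)) with hW'
  have hW'c : ContinuousOn W' (Set.Icc 0 t) := by
    have h1 := continuousOn_semigroup (r := r) hΛ hf t
    have h2 := h1 (x - 1)
    have h3 := h1 x
    have h4 := h1 (x + 1)
    have h5 := h1 (x + 1 + 1)
    have h6 := h1 (x + 1 - 1)
    simp only [hW', jumpSum]
    fun_prop
  have hWd : ∀ u ∈ Set.Ioo 0 t, HasDerivAt (fun u => Real.exp (k * u) * W u x)
      (Real.exp (k * u) * (k * W u x + W' u)) u := by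
    intro u hu
    have h1 := (hasDerivAt_semigroup (r := r) hΛ hf hu.1 x).const_mul α
    have h2 := (hasDerivAt_semigroup (r := r) hΛ hf hu.1 (x + 1)).const_mul β
    have h3 : HasDerivAt (fun u => W u x) (W' u) u := (h1.const_add c).add h2
    have h4 : HasDerivAt (fun u => Real.exp (k * u)) (Real.exp (k * u) * k) u := by
      simpa using ((hasDerivAt_id u).const_mul k).exp
    refine (h4.mul h3).congr_deriv ?_
    ring
  have hcont : ContinuousOn (fun u => Real.exp (k * u) * (k * W u x + W' u)) (Set.Icc 0 t) := by
    have := hWc x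
    fun_prop
  have hint : IntervalIntegrable (fun u => Real.exp (k * u) * (k * W u x + W' u)) volume 0 t := by
    rw [← Set.uIcc_of_le ht] at hcont
    exact hcont.intervalIntegrable
  have hftc := intervalIntegral.integral_eq_sub_of_hasDerivAt_of_le ht
    (f := fun u => Real.exp (k * u) * W u x)
    (by have := hWc x; fun_prop) hWd hint
  have hW0 : W 0 x = c + α * f x + β * f (x + 1) := by
    simp only [hW, semigroup_zero hΛ hf]
  -- Left side minus right side equals `(λ_x - λ_{x+1}) (c + (α+β) P_u f(x+1)) + (ν_{x+1} - ν_x) (c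
  -- + (α+β) P_u f(x))`, a sum of two nonpositive terms by monotonicity of the rates and `hK`.
  have hkey : ∀ u, 0 ≤ u → k * W u x + W' u ≤
      r.birth (x + 1) * W u (x + 1) + r.death x * W u (x - 1) := by
    intro u hu
    have hb := mul_nonpos_of_nonneg_of_nonpos (sub_nonneg.2 (hbirth x.le_succ)) (hK u hu (x + 1))
    have hd := mul_nonpos_of_nonneg_of_nonpos (sub_nonneg.2 (hdeath x.le_succ)) (hK u hu x)
    -- At `x = 0` the truncated `x - 1` gives the wrong neighbour, but `ν_0 = 0` removes the term.
    have hx : r.death x * W u (x - 1) = r.death x *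
        (c + α * r.semigroup u f (x - 1) + β * r.semigroup u f x) := by
      rcases x with _ | x
      · simp [r.death_zero]
      · rfl
    rw [hx]
    simp only [hW, hW', jumpSum, rate, hk, Nat.add_sub_cancel]
    simp only [Nat.succ_eq_add_one] at hb hd
    linarith
  have hexp : Real.exp (-(k * t)) * Real.exp (k * t) = 1 := by
    rw [← Real.exp_add]; simp
  have hWt : W t x = Real.exp (-(k * t)) * W 0 x +
      ∫ u in (0 : ℝ)..t, Real.exp (-(k * (t - u))) * (k * W u x + W' u) := by
    have : ∀ u, Real.exp (-(k * (t - u))) * (k * W u x + W' u) =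
        Real.exp (-(k * t)) * (Real.exp (k * u) * (k * W u x + W' u)) := fun u => by
      rw [← mul_assoc, ← Real.exp_add]
      congr 2
      ring
    simp_rw [this]
    rw [intervalIntegral.integral_const_mul, hftc]
    simp only [mul_zero, Real.exp_zero, one_mul]
    linear_combination (-W t x) * hexp
  have hint' : IntegrableOn (fun u => Real.exp (-(k * (t - u))) * (k * W u x + W' u))
      (Set.Ioc 0 t) := by
    have hc : ContinuousOn (fun u => Real.exp (-(k * (t - u))) * (k * W u x + W' u))
        (Set.Icc 0 t) := by
      have := hWc x
      fun_prop
    exact hc.integrableOn_Icc.mono_set Set.Ioc_subset_Icc_self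
  change ENNReal.ofReal (W t x) ≤ _
  rw [hWt, hW0, intervalIntegral.integral_of_le ht]
  refine ENNReal.ofReal_add_le.trans ?_
  rw [ENNReal.ofReal_mul (Real.exp_pos _).le]
  gcongr
  refine le_trans (ENNReal.ofReal_le_of_le_toReal
    (b := ∫⁻ u in Set.Ioc 0 t, ENNReal.ofReal (Real.exp (-(k * (t - u))) * (k * W u x + W' u))) ?_)
    (setLIntegral_mono' measurableSet_Ioc fun u hu => ?_)
  · rw [integral_eq_lintegral_pos_part_sub_lintegral_neg_part hint']
    exact sub_le_self _ ENNReal.toReal_nonneg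
  rw [ENNReal.ofReal_mul (Real.exp_pos _).le]
  gcongr
  rw [← ENNReal.ofReal_mul (r.birth_pos _).le, ← ENNReal.ofReal_mul (r.death_nonneg _)]
  exact (ENNReal.ofReal_le_ofReal (hkey u hu.1.le)).trans ENNReal.ofReal_add_le

/-- The Feynman-Kac semigroup of the `1`-modification dominates affine combinations of two
neighbouring values of `P_t f`. -/
lemma ofReal_affine_semigroup_le_feynmanKac {Λ : ℝ} (hΛ : ∀ x, r.birth x ≤ Λ)
    (hbirth : Antitone r.birth) (hdeath : Monotone r.death) {f : ℕ → ℝ} {C : ℝ}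
    (hf : ∀ x : ℕ, |f x| ≤ C * (1 + x)) {c α β : ℝ}
    (hK : ∀ u, 0 ≤ u → ∀ y, c + (α + β) * r.semigroup u f y ≤ 0) {g : ℕ → ℝ≥0∞}
    (hg : ∀ y, ENNReal.ofReal (c + α * f y + β * f (y + 1)) ≤ g y) {T : ℝ} (hT : 0 ≤ T) (x : ℕ) :
    ENNReal.ofReal (c + α * r.semigroup T f x + β * r.semigroup T f (x + 1)) ≤
      r.oneModification.feynmanKac r.onePotential T g x := by
  set W : ℝ → ℕ → ℝ := fun u y => c + α * r.semigroup u f y + β * r.semigroup u f (y + 1) with hW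
  set H : ℝ → ℕ → ℝ≥0∞ := fun u y => r.oneModification.feynmanKac r.onePotential u g y with hH
  have hV : ∀ y, 0 ≤ r.onePotential y := fun y => by
    rw [onePotential_eq]
    linarith [hbirth y.le_succ, hdeath y.le_succ]
  have hC : 0 ≤ C := by simpa using (abs_nonneg _).trans (hf 0)
  have hΛ0 : 0 ≤ Λ := (r.birth_pos 0).le.trans (hΛ 0)
  suffices h : ENNReal.ofReal (W T x) - H T x = 0 from tsub_eq_zero_iff_le.1 h
  -- Comparison is applied to the truncated difference of the subsolution and the solution. In the
  -- growth constant, the `2` comes from `1 + (y + 1) ≤ 2 * (1 + y)`.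
  refine r.oneModification.eq_zero_of_le_jumpIntegral (Λ := Λ)
    (k := fun y => r.oneModification.rate y + r.onePotential y)
    (D := fun u y => ENNReal.ofReal (W u y) - H u y) (T := T)
    (C := |c| + (|α| + 2 * |β|) * (Real.exp (Λ * T) * C))
    (fun y => by rw [oneModification_birth]; exact hΛ _)
    (fun y => le_add_of_nonneg_right (hV y)) ?_ ?_ ⟨hT, le_rfl⟩ x
  · intro t ht y
    choose F hFm hF using r.oneModification.exists_measurable_feynmanKac r.onePotential g
    rw [tsub_le_iff_right]
    have hsub := ofReal_affine_semigroup_le (r := r) hΛ hbirth hdeath hf hK ht.1 y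
    refine hsub.trans ?_
    have hHF : r.oneModification.jumpIntegral
        (fun y => r.oneModification.rate y + r.onePotential y) H t y =
        r.oneModification.jumpIntegral
          (fun y => r.oneModification.rate y + r.onePotential y) (fun u y => F y u) t y :=
      le_antisymm (jumpIntegral_mono _ _ _ fun u hu z => (hF z u hu.1.le).le)
        (jumpIntegral_mono _ _ _ fun u hu z => (hF z u hu.1.le).ge)
    calc _ ≤ ENNReal.ofReal (Real.exp (-((r.oneModification.rate y + r.onePotential y) * t))) *
          g y + r.oneModification.jumpIntegral
            (fun y => r.oneModification.rate y + r.onePotential y)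
            (fun u z => (ENNReal.ofReal (W u z) - H u z) + F z u) t y := by
          gcongr
          · exact hg y
          · exact jumpIntegral_mono _ _ _ fun u hu z => by
              rw [← hF z u hu.1.le]
              exact le_tsub_add
      _ = _ := by
          rw [jumpIntegral_add _ _ _ hFm, ← hHF]
          simp only [hH]
          rw [r.oneModification.feynmanKac_eq r.onePotential g ht.1 y]
          ring
  · intro t ht y
    refine tsub_le_self.trans (ENNReal.ofReal_le_ofReal ?_)
    have hS : ∀ z : ℕ, |r.semigroup t f z| ≤ Real.exp (Λ * T) * C * (1 + z) := fun z => by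
      refine (abs_semigroup_le hΛ hf ht.1 z).trans ?_
      rw [mul_assoc]
      gcongr
      exact ht.2
    have h1 := hS y
    have h2 := hS (y + 1)
    have hy : (0 : ℝ) ≤ y := Nat.cast_nonneg y
    set A := Real.exp (Λ * T) * C with hA
    have hA0 : 0 ≤ A := by positivity
    calc W t y ≤ |W t y| := le_abs_self _
      _ ≤ |c| + |α| * |r.semigroup t f y| + |β| * |r.semigroup t f (y + 1)| := by
        simp only [hW, ← abs_mul]
        exact abs_add_three _ _ _
      _ ≤ |c| * (1 + y) + |α| * (A * (1 + y)) + |β| * (A * (2 * (1 + y))) := by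
        gcongr
        · exact le_mul_of_one_le_right (abs_nonneg c) (by linarith)
        · refine h2.trans ?_
          push_cast
          gcongr
          linarith
      _ = _ := by ring

end BirthDeathRates
end

theorem mainTheorem2 (r : BirthDeathRates) (hne : r.NonExplosive)
    (hbirth : Antitone r.birth) (hdeath : Monotone r.death)
    (I : Set ℝ) (hIo : IsOpen I) (hIc : I.OrdConnected)
    (φ : ℝ → ℝ) (hφ : ContDiffOn ℝ (⊤ : ℕ∞) φ I) (hφc : ConvexOn ℝ I φ)
    (hφ2 : ∀ a ∈ I, 0 < deriv (deriv φ) a)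
    (hφi : ConvexOn ℝ I fun a => -1 / deriv (deriv φ) a)
    (f : ℕ → ℝ) (hfI : ∀ x, f x ∈ I) (hf : BddAbove (Set.range fun y => |fwdGrad f y|))
    (t : ℝ) (ht : 0 ≤ t) :
    (∀ x, MeasureTheory.IntegrableOn (fun ω => f (r.process x t ω)) (r.alive x t)
        BirthDeathRates.noise) ∧
    (∀ x, r.semigroup t f x ∈ I) ∧
    (∀ x, r.onePotential x = fwdGrad (fun y => r.death y - r.birth y) x ∧
        0 ≤ r.onePotential x) ∧
    ∀ x, ENNReal.ofReal (bTransform φ (r.semigroup t f x) (fwdGrad (r.semigroup t f) x)) ≤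
      r.oneModification.feynmanKac r.onePotential t
        (fun y => ENNReal.ofReal (bTransform φ (f y) (fwdGrad f y))) x := by
  obtain ⟨C, hC⟩ := abs_le_linear_of_bddAbove_fwdGrad hf
  have hΛ : ∀ x, r.birth x ≤ r.birth 0 := fun x => hbirth x.zero_le
  have hint : ∀ u, 0 ≤ u → ∀ x, IntegrableOn (fun ω => f (r.process x u ω)) (r.alive x u)
      BirthDeathRates.noise := fun u hu x => BirthDeathRates.integrableOn_process hΛ hC hu x
  have hmem : ∀ x, r.semigroup t f x ∈ I := fun x =>
    BirthDeathRates.semigroup_mem hne hIc hfI (hint t ht x)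
  refine ⟨hint t ht, hmem, fun x => ⟨?_, ?_⟩, fun x => ?_⟩
  · rw [r.onePotential_eq, fwdGrad]
    ring
  · rw [r.onePotential_eq]
    linarith [hbirth x.le_succ, hdeath x.le_succ]
  -- The plane is tangent at the values for the fixed `t` and `x`: equality is used at `P_t f`, the
  -- inequality at `f`.
  · obtain ⟨c, α, β, heq, hle⟩ :=
      exists_affine_le_bTransform hIo hIc hφ hφ2 hφi (hmem x) (hmem (x + 1))
    rw [fwdGrad, heq]
    refine BirthDeathRates.ofReal_affine_semigroup_le_feynmanKac hΛ hbirth hdeath hC ?_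
      (fun y => ENNReal.ofReal_le_ofReal (hle _ (hfI y) _ (hfI (y + 1)))) ht x
    intro u hu y
    refine BirthDeathRates.semigroup_affine_nonpos hne (hint u hu y) fun z => ?_
    -- On the diagonal `B^φ` vanishes, so the plane is nonpositive there.
    have h := hle _ (hfI z) _ (hfI z)
    simp only [bTransform, sub_self, mul_zero] at h
    linarith
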